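/- Let $d\in\mathbb N$ and let $\Omega\subset\mathbb R^d$ be open and bounded and satisfy the segment condition: every $x\in\partial\Omega$ has a neighbourhood $U_x$ and a vector $y_x\neq 0$ such that $z+ty_x\in\Omega$ for all $z\in\overline\Omega\cap U_x$ and $0<t<1$. Let $n,r,\ell\ge 0$ be integers, $j=\min\{n,r\}$, $m=\min\{n,\ell\}$, with $\ell\ge j$, and let $s\in\mathbb R$ satisfy $2s>d+m+1$. Let $\tau,c>0$ and let $h_k>0$ be a sequence with $h_k\to 0$. For each $k\in\mathbb N$ let $I_k$ be a finite set, let $(x_a)_{a\in I_k}$ be points (nodes) in $\mathbb R^d$, and let $(w_a)_{a\in I_k}$ be real-valued functions on $\Omega$ (shape functions), with linear span $X_k$. Suppose that for every $k$: (i) ($n$-consistency) $\sum_{a\in I_k}x_a^\alpha w_a(x)=x^\alpha$ for all $x\in\Omega$ and all multi-indices $\alpha$ with $|\alpha|\le n$; (ii) ($h_k$-density bounded by $\tau$) $\#\{a\in I_k: |x_a-x|\le h_k\}\le\tau$ for every $x\in\mathbb R^d$; (iii) (polynomial decay of order $(r,s)$) $w_a\in C^r(\Omega)$ for all $a\in I_k$,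 and $$\sup_{|\alpha|\le r}\ \sup_{x\in\Omega}\ \sup_{a\in I_k}\Bigl(1+\Bigl|\frac{x-x_a}{h_k}\Bigr|^2\Bigr)^s h_k^{|\alpha|}\,|D^\alpha w_a(x)|<c .$$ Then for every $1\le p<\infty$ and every $u\in W^{j,p}(\Omega)$ there are $u_k\in X_k$, all of them in $W^{j,p}(\Omega)$, such that $\|u_k-u\|_{W^{j,p}(\Omega)}\to 0$ as $k\to\infty$. -/

import Mathlib

open Set Filter Topology MeasureTheory
open scoped ENNReal ContDiff

namespace Meshfree

/-- The Euclidean space `ℝ^d`. -/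
abbrev E (d : ℕ) : Type := EuclideanSpace ℝ (Fin d)

/-! ### Multi-indices and partial derivatives -/

/-- A multi-index `α ∈ ℕ^d`. -/
abbrev MultiIndex (d : ℕ) : Type := Fin d → ℕ

/-- The degree `|α| = α_1 + ⋯ + α_d`. -/
def MultiIndex.degree {d : ℕ} (α : MultiIndex d) : ℕ := ∑ i, α i

/-- The monomial `x^α`. -/
noncomputable def monomial {d : ℕ} (α : MultiIndex d) (x : E d) : ℝ := ∏ i, x i ^ α i

/-- The finite set of multi-indices of degree at most `j`. -/
def multiIndices (d j : ℕ) : Finset (MultiIndex d) :=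
  (Fintype.piFinset fun _ => Finset.range (j + 1)).filter fun α => α.degree ≤ j

theorem mem_multiIndices {d j : ℕ} {α : MultiIndex d} :
    α ∈ multiIndices d j ↔ α.degree ≤ j := by
  simp only [multiIndices, Finset.mem_filter, Fintype.mem_piFinset, Finset.mem_range,
    and_iff_right_iff_imp]
  intro h i
  have := Finset.single_le_sum (f := α) (fun _ _ => Nat.zero_le _) (Finset.mem_univ i)
  exact Nat.lt_succ_of_le (this.trans h)

/-- The classical partial derivative `D^α f (x)`: the derivative of order `|α|` of `f` at `x`
applied to the standard basis vectors, where `e_i` is taken `α i` times. On an open set on which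
`f` is of class `C^{|α|}` it is determined by the values of `f` on that set. -/
noncomputable def partialDeriv {d : ℕ} (α : MultiIndex d) (f : E d → ℝ) (x : E d) : ℝ :=
  iteratedFDeriv ℝ (∑ i, α i) f x
    fun l => EuclideanSpace.single (finSigmaFinEquiv.symm l).1 1

/-! ### Sobolev spaces on an open set -/

/-- `v` is the weak derivative `D^α u` of `u` in the open set `Ω`: both are locally integrable
in `Ω` and `∫_Ω u D^α φ = (-1)^{|α|} ∫_Ω v φ` for all test functions `φ ∈ C_c^∞(Ω)`. -/
def HasWeakDeriv {d : ℕ} (Ω : Set (E d)) (α : MultiIndex d) (u v : E d → ℝ) : Prop :=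
  LocallyIntegrableOn u Ω ∧ LocallyIntegrableOn v Ω ∧
    ∀ φ : E d → ℝ, ContDiff ℝ ∞ φ → HasCompactSupport φ → tsupport φ ⊆ Ω →
      ∫ x in Ω, u x * partialDeriv α φ x = (-1) ^ α.degree * ∫ x in Ω, v x * φ x

/-- `u ∈ W^{j,p}(Ω)`: `u ∈ L^p(Ω)`, and every weak derivative `D^α u` with `|α| ≤ j` exists
and belongs to `L^p(Ω)`. -/
def MemSobolev {d : ℕ} (Ω : Set (E d)) (j : ℕ) (p : ℝ≥0∞) (u : E d → ℝ) : Prop :=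
  MemLp u p (volume.restrict Ω) ∧
    ∀ α : MultiIndex d, α.degree ≤ j →
      ∃ v, HasWeakDeriv Ω α u v ∧ MemLp v p (volume.restrict Ω)

/-- The norm `‖D^α u‖_{L^p(Ω)}` of the weak derivative. A weak derivative is unique up to a null
set, so the infimum is over a single value; it is `∞` if there is no weak derivative. -/
noncomputable def weakDerivNorm {d : ℕ} (Ω : Set (E d)) (p : ℝ≥0∞) (α : MultiIndex d)
    (u : E d → ℝ) : ℝ≥0∞ :=
  ⨅ (v : E d → ℝ) (_ : HasWeakDeriv Ω α u v), eLpNorm v p (volume.restrict Ω)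

/-- The norm `‖u‖_{W^{j,p}(Ω)} = (∑_{|α| ≤ j} ‖D^α u‖_{L^p(Ω)}^p)^{1/p}`, for finite `p`. -/
noncomputable def sobolevNorm {d : ℕ} (Ω : Set (E d)) (j : ℕ) (p : ℝ≥0∞) (u : E d → ℝ) :
    ℝ≥0∞ :=
  (∑ α ∈ multiIndices d j, weakDerivNorm Ω p α u ^ p.toReal) ^ (1 / p.toReal)

/-! ### The segment condition -/

/-- Every boundary point `x` of `Ω` has a neighbourhood `U` and a vector `y ≠ 0` such that
`z + t y ∈ Ω` for all `z ∈ closure Ω ∩ U` and `0 < t < 1`. -/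
def SegmentCondition {d : ℕ} (Ω : Set (E d)) : Prop :=
  ∀ x ∈ frontier Ω, ∃ U ∈ 𝓝 x, ∃ y : E d, y ≠ 0 ∧
    ∀ z ∈ closure Ω ∩ U, ∀ t : ℝ, 0 < t → t < 1 → z + t • y ∈ Ω

/-! ### Approximation schemes -/

/-- An approximation scheme `{I, W, P}` in `ℝ^d`: nodes `x_a` and shape functions `w_a`, both
indexed by `I`. Only the values of the shape functions in the domain `Ω` under consideration
matter. -/
structure ApproximationScheme (I : Type*) (d : ℕ) where
  /-- The point set `P`, as the family of nodes `x_a`. -/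
  node : I → E d
  /-- The shape functions `w_a`. -/
  shape : I → E d → ℝ

namespace ApproximationScheme

variable {I : Type*} {d : ℕ}

/-- The space `X` spanned by the shape functions. -/
def space (S : ApproximationScheme I d) : Submodule ℝ (E d → ℝ) :=
  Submodule.span ℝ (Set.range S.shape)

/-- Consistency of order `n` in `Ω`: `x^α = ∑_a x_a^α w_a(x)` for all `x ∈ Ω`, `|α| ≤ n`. -/
def IsConsistent [Fintype I] (S : ApproximationScheme I d) (Ω : Set (E d)) (n : ℕ) : Prop :=
  ∀ α : MultiIndex d, α.degree ≤ n → ∀ x ∈ Ω,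
    monomial α x = ∑ a, monomial α (S.node a) * S.shape a x

/-- The point set has `h`-density bounded by `τ`: every closed ball of radius `h` contains at
most `τ` nodes (a point that is repeated in the family of nodes counts as often as it occurs). -/
def HasDensityBound [Fintype I] (S : ApproximationScheme I d) (h τ : ℝ) : Prop :=
  ∀ x : E d, (Nat.card {a : I // S.node a ∈ Metric.closedBall x h} : ℝ) ≤ τ

/-- Polynomial decay of order `(r, s)` in `Ω` for the constants `c` and `h`: the shape functions
are of class `C^r` in `Ω`, and the supremum over `|α| ≤ r`, `x ∈ Ω` and `a ∈ I` of
`(1 + |(x - x_a) / h|^2)^s h^{|α|} |D^α w_a(x)|` is less than `c`. -/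
def HasPolynomialDecay (S : ApproximationScheme I d) (Ω : Set (E d)) (r : ℕ) (s c h : ℝ) :
    Prop :=
  (∀ a, ContDiffOn ℝ r (S.shape a) Ω) ∧
    ∃ c' < c, ∀ α : MultiIndex d, α.degree ≤ r → ∀ x ∈ Ω, ∀ a,
      (1 + (‖x - S.node a‖ / h) ^ 2) ^ s * h ^ α.degree * |partialDeriv α (S.shape a) x| ≤ c'

end ApproximationScheme

end Meshfree

/-! The argument separates approximation of `u` by a smooth function from approximation of a smooth
function by the scheme. Write `j = min n r`.

For `φ ∈ C_c^∞(ℝ^d)` take `∑ φ(x_a) w_a`. Fix `x ∈ Ω` and let `P` be the Taylor polynomial of `φ` at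
`x` of order `j ≤ n`. Consistency reproduces `P` on `Ω`, and `P` has the same derivatives as `φ` at
`x` up to order `j`, so the error in `D^α` at `x` equals `∑ (φ - P)(x_a) D^α w_a(x)`. The remainder
is `O(|x - x_a|^(j+1))`. With the decay of `D^α w_a` and `z_a = (x_a - x)/h`, the sum is at most a
constant times `h^(j+1-|α|) ∑ (1 + |z_a|)^(-(2s-j-1))`. Since `2s - j - 1 > d`, bounded density
bounds the last sum independently of `h`, `x` and the number of nodes. Hence the error is `O(h)`
uniformly on `Ω` (`abs_partialDeriv_interp_sub_le`). Nodes may lie outside `Ω`, so `φ` has to be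
controlled on all of `ℝ^d`.

Such `φ` are dense in `W^{j,p}(Ω)` (`exists_contDiff_eLpNorm_partialDeriv_sub_le`). The segment
condition covers the closure by finitely many patches, each of which can be pushed into `Ω` by a
small translation. Translating before mollifying keeps the kernel away from the complement of `Ω`,
and a partition of unity glues the local approximants.

The threshold for `k` depends on `φ`, hence on the tolerance; choosing almost minimizers for each
`k` yields one sequence. -/

namespace Meshfree

/-! ### Symmetry of iterated derivatives of smooth functions -/

/-- The iterated directional derivative along a list of vectors. -/
noncomputable def dirDeriv {V : Type*} [NormedAddCommGroup V] [NormedSpace ℝ V] (f : V → ℝ) :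
    List V → V → ℝ
  | [] => f
  | v :: l => fun x => fderiv ℝ (dirDeriv f l) x v

theorem contDiff_dirDeriv {V : Type*} [NormedAddCommGroup V] [NormedSpace ℝ V] {f : V → ℝ}
    (hf : ContDiff ℝ ∞ f) (l : List V) : ContDiff ℝ ∞ (dirDeriv f l) := by
  induction l with
  | nil => exact hf
  | cons v l ih => exact (ih.fderiv_right (m := ∞) (by simp)).clm_apply contDiff_const

/-- Permutations of lists are generated by swaps of the two head entries, and such a swap is
symmetry of the second derivative of the smooth function `dirDeriv f l`. -/
theorem dirDeriv_perm {V : Type*} [NormedAddCommGroup V] [NormedSpace ℝ V] {f : V → ℝ}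
    (hf : ContDiff ℝ ∞ f) {l l' : List V} (h : l.Perm l') : dirDeriv f l = dirDeriv f l' := by
  induction h with
  | nil => rfl
  | cons v _ ih => simp only [dirDeriv, ih]
  | swap v w l =>
    have hg := contDiff_dirDeriv hf l
    have hd : Differentiable ℝ (fderiv ℝ (dirDeriv f l)) :=
      (hg.fderiv_right (m := ∞) (by simp)).differentiable (by simp)
    have key (a b : V) (x : V) : fderiv ℝ (fun y => fderiv ℝ (dirDeriv f l) y a) x b =
        fderiv ℝ (fderiv ℝ (dirDeriv f l)) x b a := by
      rw [fderiv_clm_apply (hd x) (differentiableAt_const a)]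
      simp
    funext x
    have hs : IsSymmSndFDerivAt ℝ (dirDeriv f l) x :=
      hg.contDiffAt.isSymmSndFDerivAt (by
      rw [minSmoothness_of_isRCLikeNormedField]
      exact WithTop.coe_le_coe.2 (le_top : (2 : ℕ∞) ≤ ⊤))
    simp only [dirDeriv]
    rw [key, key]
    exact hs.eq _ _
  | trans _ _ ih ih' => exact ih.trans ih'

theorem dirDeriv_ofFn {V : Type*} [NormedAddCommGroup V] [NormedSpace ℝ V] {f : V → ℝ}
    (hf : ContDiff ℝ ∞ f) {k : ℕ} (m : Fin k → V) (x : V) :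
    dirDeriv f (List.ofFn m) x = iteratedFDeriv ℝ k f x m := by
  induction k generalizing x with
  | zero => simp [dirDeriv]
  | succ k ih =>
    rw [List.ofFn_succ, iteratedFDeriv_succ_apply_left]
    have : dirDeriv f (List.ofFn fun i : Fin k => m i.succ) =
        fun y => iteratedFDeriv ℝ k f y (Fin.tail m) := funext fun y => ih _ _
    have hd : DifferentiableAt ℝ (iteratedFDeriv ℝ k f) x :=
      (hf.differentiable_iteratedFDeriv (by exact_mod_cast WithTop.coe_lt_top _)) x
    simp only [dirDeriv]
    rw [this]
    have := (hd.hasFDerivAt.continuousMultilinear_apply_const (Fin.tail m)).fderiv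
    rw [this]
    rfl

theorem iteratedFDeriv_comp_perm_of_contDiff {V : Type*} [NormedAddCommGroup V]
    [NormedSpace ℝ V] {f : V → ℝ} (hf : ContDiff ℝ ∞ f) {k : ℕ} (m : Fin k → V)
    (σ : Equiv.Perm (Fin k)) (x : V) :
    iteratedFDeriv ℝ k f x (m ∘ σ) = iteratedFDeriv ℝ k f x m := by
  rw [← dirDeriv_ofFn hf, ← dirDeriv_ofFn hf, dirDeriv_perm hf (Equiv.Perm.ofFn_comp_perm σ m)]

/-! ### Partial derivatives -/

variable {d : ℕ}

/-- The basis vectors along which `D^α` differentiates. -/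
noncomputable def dirs (α : MultiIndex d) : Fin α.degree → E d :=
  fun l => EuclideanSpace.single (finSigmaFinEquiv.symm l).1 1

theorem partialDeriv_eq (α : MultiIndex d) (f : E d → ℝ) (x : E d) :
    partialDeriv α f x = iteratedFDeriv ℝ α.degree f x (dirs α) := rfl

theorem norm_dirs (α : MultiIndex d) (l) : ‖dirs α l‖ = 1 := by simp [dirs]

theorem abs_partialDeriv_le (α : MultiIndex d) (f : E d → ℝ) (x : E d) :
    |partialDeriv α f x| ≤ ‖iteratedFDeriv ℝ α.degree f x‖ := by
  rw [partialDeriv_eq, ← Real.norm_eq_abs]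
  simpa [norm_dirs] using (iteratedFDeriv ℝ α.degree f x).le_opNorm (dirs α)

theorem partialDeriv_congr {α : MultiIndex d} {f g : E d → ℝ} {x : E d} (h : f =ᶠ[𝓝 x] g) :
    partialDeriv α f x = partialDeriv α g x := by
  rw [partialDeriv_eq, partialDeriv_eq, (h.iteratedFDeriv ℝ α.degree).eq_of_nhds]

theorem partialDeriv_add {α : MultiIndex d} {f g : E d → ℝ} {x : E d}
    (hf : ContDiffAt ℝ α.degree f x) (hg : ContDiffAt ℝ α.degree g x) :
    partialDeriv α (fun y => f y + g y) x = partialDeriv α f x + partialDeriv α g x := by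
  simp only [partialDeriv_eq]
  change iteratedFDeriv ℝ α.degree (f + g) x _ = _
  rw [iteratedFDeriv_add_apply hf hg]
  rfl

theorem partialDeriv_sub {α : MultiIndex d} {f g : E d → ℝ} {x : E d}
    (hf : ContDiffAt ℝ α.degree f x) (hg : ContDiffAt ℝ α.degree g x) :
    partialDeriv α (fun y => f y - g y) x = partialDeriv α f x - partialDeriv α g x := by
  simp only [partialDeriv_eq]
  change iteratedFDeriv ℝ α.degree (f - g) x _ = _
  rw [iteratedFDeriv_sub_apply hf hg]
  rfl

theorem partialDeriv_sum {ι : Type*} {α : MultiIndex d} {s : Finset ι} {f : ι → E d → ℝ}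
    {x : E d} (hf : ∀ i ∈ s, ContDiffAt ℝ α.degree (f i) x) :
    partialDeriv α (fun y => ∑ i ∈ s, f i y) x = ∑ i ∈ s, partialDeriv α (f i) x := by
  simp only [partialDeriv_eq]
  rw [iteratedFDeriv_fun_sum_apply hf, sum_apply]

theorem partialDeriv_const_mul {α : MultiIndex d} {f : E d → ℝ} {x : E d} (c : ℝ)
    (hf : ContDiffAt ℝ α.degree f x) :
    partialDeriv α (fun y => c * f y) x = c * partialDeriv α f x := by
  simp only [partialDeriv_eq]
  have := iteratedFDeriv_const_smul_apply' (𝕜 := ℝ) (a := c) hf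
  simp only [smul_eq_mul] at this
  rw [this]
  rfl

theorem partialDeriv_comp_add_right (α : MultiIndex d) (f : E d → ℝ) (a x : E d) :
    partialDeriv α (fun y => f (y + a)) x = partialDeriv α f (x + a) := by
  simp only [partialDeriv_eq, iteratedFDeriv_comp_add_right]

theorem partialDeriv_comp_const_sub {α : MultiIndex d} {f : E d → ℝ} (hf : ContDiff ℝ ∞ f)
    (a x : E d) :
    partialDeriv α (fun y => f (a - y)) x = (-1) ^ α.degree * partialDeriv α f (a - x) := by
  have h1 : (fun y => f (a - y)) =
      (fun y => f (a + y)) ∘ (-ContinuousLinearMap.id ℝ (E d)) := by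
    funext y
    simp [sub_eq_add_neg]
  have h2 : ContDiff ℝ ∞ (fun y => f (a + y)) := hf.comp (by fun_prop)
  rw [partialDeriv_eq, partialDeriv_eq, h1,
    ContinuousLinearMap.iteratedFDeriv_comp_right (-ContinuousLinearMap.id ℝ (E d)) h2 x
      (i := α.degree) (by exact_mod_cast le_top)]
  rw [iteratedFDeriv_comp_add_left]
  have h3 : ((-ContinuousLinearMap.id ℝ (E d)) : E d → E d) ∘ dirs α =
      fun i => (-1 : ℝ) • dirs α i := by
    funext i
    simp
  rw [ContinuousMultilinearMap.compContinuousLinearMap_apply]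
  have h4 := (iteratedFDeriv ℝ α.degree f (a - x)).map_smul_univ (fun _ => (-1 : ℝ)) (dirs α)
  simp only [Finset.prod_const, Finset.card_univ, Fintype.card_fin, smul_eq_mul] at h4
  rw [← h4]
  congr 1

theorem continuousOn_partialDeriv {α : MultiIndex d} {f : E d → ℝ} {Ω : Set (E d)}
    (hΩ : IsOpen Ω) (hf : ContDiffOn ℝ α.degree f Ω) : ContinuousOn (partialDeriv α f) Ω := by
  intro x hx
  have h1 : ContinuousOn (iteratedFDerivWithin ℝ α.degree f Ω) Ω :=
    hf.continuousOn_iteratedFDerivWithin le_rfl hΩ.uniqueDiffOn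
  have h2 : ContinuousOn (iteratedFDeriv ℝ α.degree f) Ω :=
    h1.congr fun y hy => (iteratedFDerivWithin_of_isOpen α.degree hΩ hy).symm
  have := (h2 x hx)
  exact (ContinuousMultilinearMap.apply ℝ (fun _ : Fin α.degree => E d) ℝ
    (dirs α)).continuous.continuousAt.comp_continuousWithinAt this

theorem contDiff_partialDeriv (α : MultiIndex d) {f : E d → ℝ} (hf : ContDiff ℝ ∞ f) :
    ContDiff ℝ ∞ (partialDeriv α f) := by
  have h : ContDiff ℝ ∞ (iteratedFDeriv ℝ α.degree f) :=
    hf.iteratedFDeriv_right (by exact_mod_cast le_top)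
  exact (ContinuousMultilinearMap.apply ℝ (fun _ : Fin α.degree => E d) ℝ
    (dirs α)).contDiff.comp h

theorem hasCompactSupport_partialDeriv (α : MultiIndex d) {f : E d → ℝ}
    (hf : HasCompactSupport f) : HasCompactSupport (partialDeriv α f) := by
  refine (hf.iteratedFDeriv (𝕜 := ℝ) α.degree).comp_left
    (g := fun M : ContinuousMultilinearMap ℝ (fun _ : Fin α.degree => E d) ℝ => M (dirs α)) ?_
  rfl

theorem tsupport_partialDeriv_subset (α : MultiIndex d) (f : E d → ℝ) :
    tsupport (partialDeriv α f) ⊆ tsupport f := by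
  refine closure_minimal (fun x hx => ?_) isClosed_closure
  by_contra h
  apply hx
  have : f =ᶠ[𝓝 x] fun _ => 0 := notMem_tsupport_iff_eventuallyEq.mp h
  rw [partialDeriv_congr this, partialDeriv_eq, iteratedFDeriv_fun_zero]
  rfl

/-- Every mixed directional derivative of order `k` along basis vectors is a partial derivative
of order `k`. -/
theorem exists_partialDeriv_eq {k : ℕ} (w : Fin k → Fin d) :
    ∃ α : MultiIndex d, α.degree = k ∧ ∀ f : E d → ℝ, ContDiff ℝ ∞ f → ∀ x,
      iteratedFDeriv ℝ k f x (fun l => EuclideanSpace.single (w l) 1) = partialDeriv α f x := by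
  classical
  -- `α` counts the occurrences of each index in `w`, and `e` groups the positions by the fibres of
  -- `w`, which is the ordering built into `dirs α`.
  let α : MultiIndex d := fun i => Fintype.card {l // w l = i}
  let e : Fin k ≃ Fin (∑ i, α i) :=
    (Equiv.sigmaFiberEquiv w).symm.trans
      ((Equiv.sigmaCongrRight fun i => Fintype.equivFin {l // w l = i}).trans finSigmaFinEquiv)
  have hk : α.degree = k := by
    simpa [MultiIndex.degree] using (Fintype.card_congr e).symm
  have he (l) : (finSigmaFinEquiv.symm (e l)).1 = w l := by simp [e, Equiv.sigmaFiberEquiv]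
  refine ⟨α, hk, fun f hf x => ?_⟩
  -- The order `N` is a variable here so that `k = N` can be substituted; the degree of `α` could
  -- not be.
  have hgen : ∀ (N : ℕ) (e' : Fin k ≃ Fin N) (m : Fin N → E d),
      iteratedFDeriv ℝ k f x (m ∘ e') = iteratedFDeriv ℝ N f x m := by
    intro N e' m
    have : k = N := by simpa using Fintype.card_congr e'
    subst this
    exact iteratedFDeriv_comp_perm_of_contDiff hf m e' x
  have h := hgen _ e (dirs α)
  rw [partialDeriv_eq]
  refine Eq.trans ?_ h
  congr 1
  funext l
  simp only [dirs, Function.comp, he]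

/-- The norm of the `k`-th derivative is bounded by the sum of the partial derivatives of
order at most `j`, if `k ≤ j`. -/
theorem norm_iteratedFDeriv_le_sum_partialDeriv {j k : ℕ} (hk : k ≤ j) {f : E d → ℝ}
    (hf : ContDiff ℝ ∞ f) (x : E d) :
    ‖iteratedFDeriv ℝ k f x‖ ≤ (d : ℝ) ^ k * ∑ α ∈ multiIndices d j, |partialDeriv α f x| := by
  have hnn : 0 ≤ ∑ α ∈ multiIndices d j, |partialDeriv α f x| :=
    Finset.sum_nonneg fun _ _ => abs_nonneg _
  refine ContinuousMultilinearMap.opNorm_le_bound (by positivity) fun m => ?_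
  have hm : m = fun l => ∑ i, m l i • EuclideanSpace.single i (1 : ℝ) := by
    funext l
    ext i
    simp [Pi.single_apply]
  conv_lhs => rw [hm]
  rw [ContinuousMultilinearMap.map_sum]
  refine (norm_sum_le _ _).trans ?_
  have hterm : ∀ w : Fin k → Fin d,
      ‖iteratedFDeriv ℝ k f x (fun l => m l (w l) • EuclideanSpace.single (w l) (1 : ℝ))‖ ≤
        (∏ l, ‖m l‖) * ∑ α ∈ multiIndices d j, |partialDeriv α f x| := by
    intro w
    obtain ⟨α, hα, h⟩ := exists_partialDeriv_eq w
    rw [ContinuousMultilinearMap.map_smul_univ, h f hf x, norm_smul, norm_prod]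
    gcongr with l
    · exact PiLp.norm_apply_le (m l) (w l)
    · exact Finset.single_le_sum (f := fun α => |partialDeriv α f x|)
        (fun _ _ => abs_nonneg _) (mem_multiIndices.2 (hα.trans_le hk))
  refine (Finset.sum_le_sum fun w _ => hterm w).trans ?_
  simp only [Finset.sum_const, Finset.card_univ, Fintype.card_pi, Fintype.card_fin,
    Finset.prod_const, nsmul_eq_mul]
  push_cast
  apply le_of_eq
  ring

/-! ### Weak derivatives -/

/-- Continuity only has to be checked on `tsupport ψ`, so the values of `f` outside `Ω` are
irrelevant. -/
theorem continuous_mul_of_tsupport_subset {Ω : Set (E d)} (hΩ : IsOpen Ω) {f ψ : E d → ℝ}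
    (hf : ContinuousOn f Ω) (hψ : Continuous ψ) (hs : tsupport ψ ⊆ Ω) :
    Continuous fun x => f x * ψ x := by
  refine continuous_of_tsupport fun x hx => ?_
  have hx' : x ∈ Ω := hs (tsupport_mul_subset_right hx)
  exact (hf.continuousAt (hΩ.mem_nhds hx')).mul hψ.continuousAt

theorem integrable_mul_of_tsupport_subset {Ω : Set (E d)} (hΩ : IsOpen Ω) {f ψ : E d → ℝ}
    (hf : ContinuousOn f Ω) (hψ : Continuous ψ) (hc : HasCompactSupport ψ)
    (hs : tsupport ψ ⊆ Ω) : Integrable fun x => f x * ψ x :=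
  (continuous_mul_of_tsupport_subset hΩ hf hψ hs).integrable_of_hasCompactSupport hc.mul_left

theorem setIntegral_mul_eq_integral {Ω : Set (E d)} {f ψ : E d → ℝ} (hs : tsupport ψ ⊆ Ω) :
    ∫ x in Ω, f x * ψ x = ∫ x, f x * ψ x := by
  refine setIntegral_eq_integral_of_forall_compl_eq_zero fun x hx => ?_
  rw [image_eq_zero_of_notMem_tsupport fun h => hx (hs h), mul_zero]

/-- Repeated integration by parts. -/
theorem integral_mul_iteratedFDeriv {Ω : Set (E d)} (hΩ : IsOpen Ω) {φ : E d → ℝ}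
    (hφ : ContDiff ℝ ∞ φ) (hc : HasCompactSupport φ) (hs : tsupport φ ⊆ Ω) {k : ℕ}
    (m : Fin k → E d) {f : E d → ℝ} (hf : ContDiffOn ℝ k f Ω) :
    ∫ x, f x * iteratedFDeriv ℝ k φ x (m ∘ Fin.rev) =
      (-1) ^ k * ∫ x, iteratedFDeriv ℝ k f x m * φ x := by
  induction k generalizing f with
  | zero => simp
  | succ k ih =>
    -- The last direction is the innermost derivative on `f` and, because of `Fin.rev`, the
    -- outermost one on `φ`. One integration by parts moves it from `ψ` to `f`, and the induction
    -- hypothesis applies to `∂_v f`.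
    set v := m (Fin.last k)
    set ψ : E d → ℝ := fun x => iteratedFDeriv ℝ k φ x (Fin.init m ∘ Fin.rev) with hψ_def
    have hk : ContDiff ℝ ∞ (iteratedFDeriv ℝ k φ) :=
      hφ.iteratedFDeriv_right (by exact_mod_cast le_top)
    have hψ : ContDiff ℝ ∞ ψ := (ContinuousMultilinearMap.apply ℝ (fun _ : Fin k => E d) ℝ
      (Fin.init m ∘ Fin.rev)).contDiff.comp hk
    have hψc : HasCompactSupport ψ := (hc.iteratedFDeriv (𝕜 := ℝ) k).comp_left
      (g := fun M : ContinuousMultilinearMap ℝ (fun _ : Fin k => E d) ℝ =>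
        M (Fin.init m ∘ Fin.rev)) rfl
    have hψs : tsupport ψ ⊆ Ω := by
      refine (closure_minimal (fun x hx => ?_) isClosed_closure).trans
        ((tsupport_iteratedFDeriv_subset (𝕜 := ℝ) (f := φ) k).trans hs)
      apply subset_tsupport
      intro h
      apply hx
      simp [hψ_def, h]
    have hf' : ContDiffOn ℝ k (fderiv ℝ f) Ω := by
      exact ((contDiffOn_succ_iff_fderiv_of_isOpen hΩ).1 (by exact_mod_cast hf)).2.2
    have hfd : ∀ x ∈ Ω, DifferentiableAt ℝ f x := fun x hx =>
      (hf.contDiffAt (hΩ.mem_nhds hx)).differentiableAt (by simp)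
    have hfv : ContDiffOn ℝ k (fun x => fderiv ℝ f x v) Ω := hf'.clm_apply contDiffOn_const
    have h1 : ∀ x, iteratedFDeriv ℝ (k + 1) φ x (m ∘ Fin.rev) = fderiv ℝ ψ x v := by
      intro x
      have := ((hk.differentiable (by simp) x).hasFDerivAt.continuousMultilinear_apply_const
        (Fin.init m ∘ Fin.rev)).fderiv
      rw [hψ_def, this, iteratedFDeriv_succ_apply_left]
      simp only [Function.comp, Fin.rev_zero]
      rw [ContinuousLinearMap.flipMultilinear_apply_apply]
      congr 1
      funext i
      simp [Fin.tail, Fin.init, Fin.rev_succ]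
    have h2 : ∀ x ∈ Ω, iteratedFDeriv ℝ (k + 1) f x m =
        iteratedFDeriv ℝ k (fun x => fderiv ℝ f x v) x (Fin.init m) := by
      intro x hx
      rw [iteratedFDeriv_succ_apply_right]
      have := (ContinuousLinearMap.apply ℝ ℝ v).iteratedFDeriv_comp_left
        (hf'.contDiffAt (hΩ.mem_nhds hx)) (i := k) le_rfl
      have h3 : (fun x => fderiv ℝ f x v) = (ContinuousLinearMap.apply ℝ ℝ v) ∘ fderiv ℝ f := rfl
      rw [h3, this]
      rfl
    have hψ' : Continuous fun x => fderiv ℝ ψ x v :=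
      (hψ.continuous_fderiv (by simp)).clm_apply continuous_const
    have hψ's : tsupport (fun x => fderiv ℝ ψ x v) ⊆ Ω :=
      (tsupport_fderiv_apply_subset ℝ v).trans hψs
    have hψ'c : HasCompactSupport fun x => fderiv ℝ ψ x v := hψc.fderiv_apply (𝕜 := ℝ) v
    calc ∫ x, f x * iteratedFDeriv ℝ (k + 1) φ x (m ∘ Fin.rev)
        = ∫ x, f x * fderiv ℝ ψ x v := by simp only [h1]
      _ = - ∫ x, fderiv ℝ f x v * ψ x :=
          integral_mul_fderiv_eq_neg_fderiv_mul_of_integrable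
            (integrable_mul_of_tsupport_subset hΩ hfv.continuousOn hψ.continuous hψc hψs)
            (integrable_mul_of_tsupport_subset hΩ hf.continuousOn hψ' hψ'c hψ's)
            (integrable_mul_of_tsupport_subset hΩ hf.continuousOn hψ.continuous hψc hψs)
            (fun x hx => hfd x (hψs hx)) (fun x _ => hψ.differentiable (by simp) x)
      _ = (-1) ^ (k + 1) * ∫ x, iteratedFDeriv ℝ k (fun x => fderiv ℝ f x v) x (Fin.init m) *
            φ x := by
          rw [ih (Fin.init m) hfv]
          ring
      _ = (-1) ^ (k + 1) * ∫ x, iteratedFDeriv ℝ (k + 1) f x m * φ x := by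
          congr 1
          refine integral_congr_ae (Eventually.of_forall fun x => ?_)
          by_cases hx : x ∈ Ω
          · simp only [h2 x hx]
          · simp only [image_eq_zero_of_notMem_tsupport fun h => hx (hs h), mul_zero]

/-- A classical derivative is a weak derivative. -/
theorem hasWeakDeriv_of_contDiffOn {Ω : Set (E d)} (hΩ : IsOpen Ω) {α : MultiIndex d}
    {f : E d → ℝ} (hf : ContDiffOn ℝ α.degree f Ω) :
    HasWeakDeriv Ω α f (partialDeriv α f) := by
  refine ⟨hf.continuousOn.locallyIntegrableOn hΩ.measurableSet,
    (continuousOn_partialDeriv hΩ hf).locallyIntegrableOn hΩ.measurableSet,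
    fun φ hφ hc hs => ?_⟩
  rw [setIntegral_mul_eq_integral hs,
    setIntegral_mul_eq_integral ((tsupport_partialDeriv_subset α φ).trans hs)]
  simp only [partialDeriv_eq]
  rw [← integral_mul_iteratedFDeriv hΩ hφ hc hs (dirs α) hf]
  congr 1
  funext x
  -- The reversal is undone on the test function, which is smooth, while `f` is only of class
  -- `C^{|α|}`.
  rw [← iteratedFDeriv_comp_perm_of_contDiff hφ (dirs α) Fin.revPerm]
  rfl

theorem integrable_mul_continuous {Ω : Set (E d)} {u ψ : E d → ℝ}
    (hu : Integrable u (volume.restrict Ω)) (hψ : Continuous ψ) (hc : HasCompactSupport ψ) :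
    Integrable (fun x => u x * ψ x) (volume.restrict Ω) := by
  obtain ⟨C, hC⟩ := hψ.bounded_above_of_compact_support hc
  exact hu.mul_bdd hψ.aestronglyMeasurable (Eventually.of_forall hC)

theorem HasWeakDeriv.sub {Ω : Set (E d)} {α : MultiIndex d} {u u' v v' : E d → ℝ}
    (h : HasWeakDeriv Ω α u v) (h' : HasWeakDeriv Ω α u' v')
    (hu : Integrable u (volume.restrict Ω)) (hv : Integrable v (volume.restrict Ω))
    (hu' : Integrable u' (volume.restrict Ω)) (hv' : Integrable v' (volume.restrict Ω)) :
    HasWeakDeriv Ω α (u - u') (v - v') := by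
  refine ⟨h.1.sub h'.1, h.2.1.sub h'.2.1, fun φ hφ hc hs => ?_⟩
  have hD := (contDiff_partialDeriv α hφ).continuous
  have hDc := hasCompactSupport_partialDeriv α hc
  simp only [Pi.sub_apply, sub_mul]
  rw [integral_sub (integrable_mul_continuous hu hD hDc) (integrable_mul_continuous hu' hD hDc),
    integral_sub (integrable_mul_continuous hv hφ.continuous hc)
      (integrable_mul_continuous hv' hφ.continuous hc), h.2.2 φ hφ hc hs, h'.2.2 φ hφ hc hs]
  ring

theorem MemLp.integrable_of_isBounded {Ω : Set (E d)} (hΩ : Bornology.IsBounded Ω) {p : ℝ≥0∞}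
    (hp : 1 ≤ p) {u : E d → ℝ} (hu : MemLp u p (volume.restrict Ω)) :
    Integrable u (volume.restrict Ω) := by
  have : IsFiniteMeasure (volume.restrict Ω) := isFiniteMeasure_restrict.2 hΩ.measure_lt_top.ne
  exact hu.integrable hp

/-- Only upper bounds for Sobolev norms are needed, so uniqueness of weak derivatives never enters.
-/
theorem weakDerivNorm_le {Ω : Set (E d)} {p : ℝ≥0∞} {α : MultiIndex d} {u v : E d → ℝ}
    (h : HasWeakDeriv Ω α u v) : weakDerivNorm Ω p α u ≤ eLpNorm v p (volume.restrict Ω) :=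
  iInf₂_le v h

/-! ### Polynomials -/

/-- The space of polynomial functions of degree at most `j`. -/
def polys (d j : ℕ) : Submodule ℝ (E d → ℝ) :=
  Submodule.span ℝ (monomial '' {α | α.degree ≤ j})

theorem polys_mono {i j : ℕ} (h : i ≤ j) : polys d i ≤ polys d j :=
  Submodule.span_mono (image_mono fun _ hα => le_trans hα h)

theorem mul_mem_polys {i j : ℕ} {f g : E d → ℝ} (hf : f ∈ polys d i) (hg : g ∈ polys d j) :
    f * g ∈ polys d (i + j) := by
  have h := Submodule.mul_mem_mul hf hg
  rw [polys, polys, Submodule.span_mul_span] at h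
  refine Submodule.span_mono ?_ h
  rintro _ ⟨_, ⟨α, hα, rfl⟩, _, ⟨β, hβ, rfl⟩, rfl⟩
  refine ⟨α + β, ?_, ?_⟩
  · simp only [mem_ofPred_eq, MultiIndex.degree, Pi.add_apply, Finset.sum_add_distrib] at *
    exact add_le_add hα hβ
  · funext x
    simp [monomial, pow_add, Finset.prod_mul_distrib]

theorem one_mem_polys : (1 : E d → ℝ) ∈ polys d 0 := by
  refine Submodule.subset_span ⟨0, by simp [MultiIndex.degree], ?_⟩
  funext x
  simp [monomial]

theorem coord_sub_mem_polys (i : Fin d) (a : ℝ) : (fun y : E d => y i - a) ∈ polys d 1 := by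
  have h1 : (fun y : E d => y i) ∈ polys d 1 := by
    refine Submodule.subset_span ⟨Pi.single i 1, by simp [MultiIndex.degree], ?_⟩
    funext x
    simp only [monomial]
    rw [Finset.prod_eq_single i (fun b _ hb => by simp [hb]) (by simp)]
    simp
  have h2 := (polys d 1).sub_mem h1
    ((polys d 1).smul_mem a (polys_mono zero_le_one (one_mem_polys (d := d))))
  convert h2 using 1
  funext y
  simp

theorem prod_mem_polys (k : ℕ) (f : Fin k → E d → ℝ) (hf : ∀ l, f l ∈ polys d 1) :
    (∏ l, f l) ∈ polys d k := by
  induction k with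
  | zero => simpa using one_mem_polys
  | succ k ih =>
    rw [Fin.prod_univ_castSucc]
    exact mul_mem_polys (ih _ fun l => hf _) (hf _)

/-- Expansion in the standard basis gives products of `k` affine coordinate functions. This
recentres Taylor polynomials at the origin, where the monomials of the consistency condition live.
-/
theorem multilinear_diag_mem_polys {k : ℕ} (M : ContinuousMultilinearMap ℝ (fun _ : Fin k => E d) ℝ)
    (x : E d) : (fun y => M fun _ => y - x) ∈ polys d k := by
  have h : (fun y => M fun _ => y - x) = ∑ w : Fin k → Fin d,
      (M fun l => EuclideanSpace.single (w l) 1) • ∏ l, fun y : E d => y (w l) - x (w l) := by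
    funext y
    have hy : (fun _ : Fin k => y - x) =
        fun _ => ∑ i, (y i - x i) • EuclideanSpace.single i (1 : ℝ) := by
      funext l
      ext i
      simp [Pi.single_apply]
    rw [hy, ContinuousMultilinearMap.map_sum]
    simp only [ContinuousMultilinearMap.map_smul_univ, Finset.sum_apply, Pi.smul_apply,
      Finset.prod_apply, smul_eq_mul, mul_comm]
  rw [h]
  exact Submodule.sum_mem _ fun w _ => Submodule.smul_mem _ _
    (prod_mem_polys k _ fun l => coord_sub_mem_polys _ _)

/-! ### Taylor polynomials -/

/-- The Taylor polynomial of order `j` of `φ` at `x`. -/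
noncomputable def taylorPoly (j : ℕ) (φ : E d → ℝ) (x y : E d) : ℝ :=
  ∑ k ∈ Finset.range (j + 1), (k.factorial : ℝ)⁻¹ * iteratedFDeriv ℝ k φ x fun _ => y - x

theorem taylorPoly_mem_polys (j : ℕ) (φ : E d → ℝ) (x : E d) :
    taylorPoly j φ x ∈ polys d j := by
  have : taylorPoly j φ x = ∑ k ∈ Finset.range (j + 1),
      (k.factorial : ℝ)⁻¹ • fun y => iteratedFDeriv ℝ k φ x fun _ => y - x := by
    funext y
    simp [taylorPoly]
  rw [this]
  exact Submodule.sum_mem _ fun k hk => Submodule.smul_mem _ _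
    (polys_mono (Nat.lt_succ_iff.1 (Finset.mem_range.1 hk)) (multilinear_diag_mem_polys _ _))

/-- The Taylor polynomial is the sum of the finite power series `q`. Its `k`-th derivative at the
centre is the sum of `q k` over all permutations of the arguments; by symmetry these are `k!` equal
terms, cancelling the factorial. -/
theorem iteratedFDeriv_taylorPoly {j k : ℕ} (hk : k ≤ j) {φ : E d → ℝ} (hφ : ContDiff ℝ ∞ φ)
    (x : E d) : iteratedFDeriv ℝ k (taylorPoly j φ x) x = iteratedFDeriv ℝ k φ x := by
  let q : FormalMultilinearSeries ℝ (E d) ℝ := fun i =>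
    if i ≤ j then (i.factorial : ℝ)⁻¹ • iteratedFDeriv ℝ i φ x else 0
  have hq : HasFiniteFPowerSeriesOnBall (taylorPoly j φ x) q x (j + 1) ⊤ := by
    refine HasFiniteFPowerSeriesOnBall.mk' (fun m hm => ?_) (by simp) (fun y _ => ?_)
    · simp only [q, if_neg (by omega : ¬ m ≤ j)]
    · rw [taylorPoly]
      refine Finset.sum_congr rfl fun i hi => ?_
      simp only [q, if_pos (Nat.lt_succ_iff.1 (Finset.mem_range.1 hi)), add_sub_cancel_left]
      rfl
  ext m
  rw [hq.toHasFPowerSeriesOnBall.iteratedFDeriv_eq_sum_of_completeSpace]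
  have (σ : Equiv.Perm (Fin k)) : q k (fun i => m (σ i)) =
      (k.factorial : ℝ)⁻¹ * iteratedFDeriv ℝ k φ x m := by
    simp only [q, if_pos hk]
    rw [← iteratedFDeriv_comp_perm_of_contDiff hφ m σ x]
    rfl
  simp only [this, Finset.sum_const, Finset.card_univ, Fintype.card_perm, Fintype.card_fin,
    nsmul_eq_mul]
  field_simp

theorem partialDeriv_taylorPoly {j : ℕ} {α : MultiIndex d} (hα : α.degree ≤ j) {φ : E d → ℝ}
    (hφ : ContDiff ℝ ∞ φ) (x : E d) :
    partialDeriv α (taylorPoly j φ x) x = partialDeriv α φ x := by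
  rw [partialDeriv_eq, partialDeriv_eq, iteratedFDeriv_taylorPoly hα hφ]

theorem iteratedDeriv_comp_line {φ : E d → ℝ} (hφ : ContDiff ℝ ∞ φ) (x v : E d) (k : ℕ) (t : ℝ) :
    iteratedDeriv k (fun t : ℝ => φ (x + t • v)) t =
      iteratedFDeriv ℝ k φ (x + t • v) fun _ => v := by
  have h1 : (fun t : ℝ => φ (x + t • v)) =
      (fun y => φ (x + y)) ∘ ((1 : ℝ →L[ℝ] ℝ).smulRight v) := by
    funext t
    simp
  have h2 : ContDiff ℝ ∞ (fun y => φ (x + y)) := hφ.comp (by fun_prop)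
  rw [iteratedDeriv_eq_iteratedFDeriv, h1,
    ContinuousLinearMap.iteratedFDeriv_comp_right _ h2 t (i := k)
      (by exact_mod_cast le_top), iteratedFDeriv_comp_add_left]
  simp

/-- Lagrange's remainder formula for the restriction of `φ` to the segment from `x` to `y`, with the
factorial discarded. -/
theorem abs_sub_taylorPoly_le {j : ℕ} {φ : E d → ℝ} (hφ : ContDiff ℝ ∞ φ) {M : ℝ}
    (hM : ∀ y, ‖iteratedFDeriv ℝ (j + 1) φ y‖ ≤ M) (x y : E d) :
    |φ y - taylorPoly j φ x y| ≤ M * ‖y - x‖ ^ (j + 1) := by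
  set g : ℝ → ℝ := fun t => φ (x + t • (y - x)) with hg_def
  have hg : ContDiff ℝ ∞ g := hφ.comp (by fun_prop)
  obtain ⟨t, ht, h⟩ := taylor_mean_remainder_lagrange_iteratedDeriv (f := g) (x₀ := 0) (x := 1)
    (n := j) zero_ne_one
    (hg.of_le (by exact_mod_cast le_top)).contDiffOn
  have hT : taylorWithinEval g j (uIcc 0 1) 0 1 = taylorPoly j φ x y := by
    rw [taylor_within_apply, taylorPoly]
    refine Finset.sum_congr rfl fun k _ => ?_
    rw [iteratedDerivWithin_eq_iteratedDeriv (uniqueDiffOn_uIcc zero_ne_one)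
      (hg.of_le (by exact_mod_cast le_top)).contDiffAt left_mem_uIcc,
      iteratedDeriv_comp_line hφ]
    simp
  rw [hT, iteratedDeriv_comp_line hφ] at h
  have hg1 : g 1 = φ y := by simp [hg_def]
  rw [hg1] at h
  rw [h]
  simp only [sub_zero, one_pow, mul_one]
  rw [abs_div, Nat.abs_cast]
  refine (div_le_self (abs_nonneg _)
    (by exact_mod_cast Nat.succ_le_of_lt (Nat.factorial_pos _))).trans ?_
  refine ((iteratedFDeriv ℝ (j + 1) φ (x + t • (y - x))).le_opNorm _).trans ?_
  simp only [Finset.prod_const, Finset.card_univ, Fintype.card_fin]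
  gcongr
  exact hM _

/-! ### Sums over nodes -/

/-- The constant in the bound for sums of decaying functions over nodes. -/
noncomputable def nodeSumConst (d : ℕ) (ρ : ℝ) : ℝ :=
  2 ^ ρ * (∫ y : E d, (1 + ‖y‖) ^ (-ρ)) / volume.real (Metric.closedBall (0 : E d) 1)

/-- Each term is compared with the integral of the same weight over the unit ball about `z a`. At a
point `y` at most `τ` of these balls overlap, so the sum is controlled by `τ` times an integral that
converges for `ρ > d`. -/
theorem sum_node_decay_le {I : Type*} [Fintype I] (z : I → E d) {τ ρ : ℝ} (hρ : (d : ℝ) < ρ)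
    (hz : ∀ y, (Nat.card {a // z a ∈ Metric.closedBall y 1} : ℝ) ≤ τ) :
    ∑ a, (1 + ‖z a‖) ^ (-ρ) ≤ nodeSumConst d ρ * τ := by
  classical
  set V := volume.real (Metric.closedBall (0 : E d) 1) with hV
  have hVpos : 0 < V := by
    rw [hV, measureReal_def]
    exact ENNReal.toReal_pos (Metric.measure_closedBall_pos _ _ one_pos).ne'
      measure_closedBall_lt_top.ne
  have hρ0 : 0 < ρ := (Nat.cast_nonneg d).trans_lt hρ
  have hint : Integrable fun y : E d => (1 + ‖y‖) ^ (-ρ) :=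
    integrable_one_add_norm (by simpa using hρ)
  -- On the unit ball about `z a` one has `1 + ‖y‖ ≤ 2 (1 + ‖z a‖)`; this is the origin of `2 ^ ρ`.
  set G : E d → ℝ := fun y => 2 ^ ρ * (1 + ‖y‖) ^ (-ρ) with hG
  have hGint : Integrable G := hint.const_mul _
  have hGnn (y) : 0 ≤ G y := by positivity
  have hball (a : I) : volume.real (Metric.closedBall (z a) 1) = V := by
    simp only [hV, measureReal_def, Measure.addHaar_closedBall_center]
  have hterm (a : I) : (1 + ‖z a‖) ^ (-ρ) * V ≤
      ∫ y, (Metric.closedBall (z a) 1).indicator G y := by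
    rw [integral_indicator Metric.isClosed_closedBall.measurableSet]
    have h1 : ∫ _ in Metric.closedBall (z a) 1, (1 + ‖z a‖) ^ (-ρ) = (1 + ‖z a‖) ^ (-ρ) * V := by
      rw [setIntegral_const, hball, smul_eq_mul, mul_comm]
    rw [← h1]
    refine setIntegral_mono_on (integrableOn_const (by exact measure_closedBall_lt_top.ne))
      hGint.integrableOn Metric.isClosed_closedBall.measurableSet fun y hy => ?_
    have h2 : ‖y‖ ≤ ‖z a‖ + 1 := by
      have : ‖y - z a‖ ≤ 1 := by simpa [dist_eq_norm] using hy
      linarith [norm_le_norm_add_norm_sub (z a) y, norm_sub_rev y (z a)]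
    have h3 : (2 * (1 + ‖z a‖)) ^ (-ρ) ≤ (1 + ‖y‖) ^ (-ρ) :=
      Real.rpow_le_rpow_of_nonpos (by positivity) (by linarith [norm_nonneg (z a)]) (by linarith)
    rw [Real.mul_rpow (by norm_num) (by positivity)] at h3
    calc (1 + ‖z a‖) ^ (-ρ) = 2 ^ ρ * (2 ^ (-ρ) * (1 + ‖z a‖) ^ (-ρ)) := by
          rw [← mul_assoc, ← Real.rpow_add (by norm_num)]
          simp
      _ ≤ G y := by
          exact mul_le_mul_of_nonneg_left h3 (by positivity)
  have hsum : (∑ a, (1 + ‖z a‖) ^ (-ρ)) * V ≤ τ * ∫ y, G y := by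
    calc (∑ a, (1 + ‖z a‖) ^ (-ρ)) * V
        ≤ ∑ a, ∫ y, (Metric.closedBall (z a) 1).indicator G y := by
          rw [Finset.sum_mul]
          exact Finset.sum_le_sum fun a _ => hterm a
      _ = ∫ y, ∑ a, (Metric.closedBall (z a) 1).indicator G y := by
          rw [integral_finsetSum _ fun a _ =>
            hGint.indicator Metric.isClosed_closedBall.measurableSet]
      _ ≤ ∫ y, τ * G y := by
          refine integral_mono (integrable_finsetSum _ fun a _ =>
            hGint.indicator Metric.isClosed_closedBall.measurableSet) (hGint.const_mul _)
            fun y => ?_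
          have : ∑ a, (Metric.closedBall (z a) 1).indicator G y =
              (Nat.card {a // z a ∈ Metric.closedBall y 1} : ℝ) * G y := by
            rw [Nat.card_eq_fintype_card, Fintype.card_subtype]
            simp only [indicator_apply, Metric.mem_closedBall, dist_comm y]
            rw [← Finset.sum_filter, Finset.sum_const, nsmul_eq_mul]
          simp only [this]
          exact mul_le_mul_of_nonneg_right (hz y) (hGnn y)
      _ = τ * ∫ y, G y := integral_const_mul _ _
  rw [hG, integral_const_mul] at hsum
  rw [nodeSumConst, div_mul_eq_mul_div, le_div_iff₀ hVpos]
  linarith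

/-- From `(1 + t)^2 ≤ 2 (1 + t^2)`. With `q = j + 1` it shows how much decay is left after paying
for the Taylor remainder. -/
theorem pow_mul_rpow_neg_le {s t : ℝ} (hs : 0 ≤ s) (ht : 0 ≤ t) (q : ℕ) :
    t ^ q / (1 + t ^ 2) ^ s ≤ 2 ^ s * (1 + t) ^ (-(2 * s - q)) := by
  have h1 : (1 + t) ^ (2 * s) ≤ 2 ^ s * (1 + t ^ 2) ^ s := by
    rw [← Real.mul_rpow (by norm_num) (by positivity), Real.rpow_mul (by positivity)]
    refine Real.rpow_le_rpow (by positivity) ?_ hs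
    norm_cast
    nlinarith [sq_nonneg (1 - t)]
  have h2 : (1 + t) ^ (-(2 * s - q)) = (1 + t) ^ q / (1 + t) ^ (2 * s) := by
    rw [neg_sub, Real.rpow_sub (by positivity), Real.rpow_natCast]
  have h3 : t ^ q ≤ (1 + t) ^ q := by gcongr; linarith
  rw [h2, mul_div_assoc', div_le_div_iff₀ (by positivity) (by positivity)]
  calc t ^ q * (1 + t) ^ (2 * s) ≤ (1 + t) ^ q * (2 ^ s * (1 + t ^ 2) ^ s) := by gcongr
    _ = _ := by ring

/-! ### Approximation of smooth functions -/

namespace ApproximationScheme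

/-- The approximation of `φ` in the space of a scheme. -/
def interp {I : Type*} [Fintype I] (S : ApproximationScheme I d) (φ : E d → ℝ) (x : E d) : ℝ :=
  ∑ a, φ (S.node a) * S.shape a x

theorem interp_mem_space {I : Type*} [Fintype I] (S : ApproximationScheme I d) (φ : E d → ℝ) :
    S.interp φ ∈ S.space := by
  have : S.interp φ = ∑ a, φ (S.node a) • S.shape a := by
    funext x
    simp [interp]
  rw [this]
  exact Submodule.sum_mem _ fun a _ => Submodule.smul_mem _ _
    (Submodule.subset_span (mem_range_self a))

theorem IsConsistent.interp_eq {I : Type*} [Fintype I] {S : ApproximationScheme I d}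
    {Ω : Set (E d)} {n : ℕ} (h : S.IsConsistent Ω n) {P : E d → ℝ} (hP : P ∈ polys d n) {x : E d}
    (hx : x ∈ Ω) : S.interp P x = P x := by
  induction hP using Submodule.span_induction with
  | mem P hP =>
    obtain ⟨α, hα, rfl⟩ := hP
    exact (h α hα x hx).symm
  | zero => simp [interp]
  | add P Q _ _ hP hQ =>
    simp only [interp, Pi.add_apply, add_mul, Finset.sum_add_distrib] at *
    rw [hP, hQ]
  | smul c P _ hP =>
    simp only [interp, Pi.smul_apply, smul_eq_mul, mul_assoc, ← Finset.mul_sum] at *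
    rw [hP]

theorem contDiffOn_interp {I : Type*} [Fintype I] {S : ApproximationScheme I d} {Ω : Set (E d)}
    {r : ℕ} (hS : ∀ a, ContDiffOn ℝ r (S.shape a) Ω) (φ : E d → ℝ) :
    ContDiffOn ℝ r (S.interp φ) Ω :=
  ContDiffOn.sum fun a _ => contDiffOn_const.mul (hS a)

theorem partialDeriv_interp {I : Type*} [Fintype I] {S : ApproximationScheme I d} {Ω : Set (E d)}
    (hΩ : IsOpen Ω) {r : ℕ} (hS : ∀ a, ContDiffOn ℝ r (S.shape a) Ω) (φ : E d → ℝ)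
    {α : MultiIndex d} (hα : α.degree ≤ r) {x : E d} (hx : x ∈ Ω) :
    partialDeriv α (S.interp φ) x = ∑ a, φ (S.node a) * partialDeriv α (S.shape a) x := by
  have h (a) : ContDiffAt ℝ α.degree (S.shape a) x :=
    ((hS a).contDiffAt (hΩ.mem_nhds hx)).of_le (by exact_mod_cast hα)
  have h0 : S.interp φ = fun x => ∑ a, φ (S.node a) * S.shape a x := rfl
  rw [h0, partialDeriv_sum fun a _ => contDiffAt_const.mul (h a)]
  exact Finset.sum_congr rfl fun a _ => partialDeriv_const_mul _ (h a)

/-- The error of the approximation of a smooth function, and of its derivatives up to order `j`,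
is of order `h`. -/
theorem abs_partialDeriv_interp_sub_le {I : Type*} [Fintype I] {S : ApproximationScheme I d}
    {Ω : Set (E d)} (hΩ : IsOpen Ω) {n r j : ℕ} (hjn : j ≤ n) (hjr : j ≤ r) {s τ c h M : ℝ}
    (hs : (d : ℝ) + j + 1 < 2 * s) (hc : 0 < c) (hh : 0 < h) (hh1 : h ≤ 1)
    (hcons : S.IsConsistent Ω n) (hdens : S.HasDensityBound h τ)
    (hdec : S.HasPolynomialDecay Ω r s c h) {φ : E d → ℝ} (hφ : ContDiff ℝ ∞ φ)
    (hM : ∀ y, ‖iteratedFDeriv ℝ (j + 1) φ y‖ ≤ M) {α : MultiIndex d} (hα : α.degree ≤ j)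
    {x : E d} (hx : x ∈ Ω) :
    |partialDeriv α (S.interp φ) x - partialDeriv α φ x| ≤
      M * c * 2 ^ s * (nodeSumConst d (2 * s - (j + 1 : ℕ)) * τ) * h := by
  have hM0 : 0 ≤ M := (norm_nonneg _).trans (hM 0)
  have hs0 : 0 ≤ s := by
    have : (0 : ℝ) ≤ d := Nat.cast_nonneg d
    have : (0 : ℝ) ≤ j := Nat.cast_nonneg j
    linarith
  obtain ⟨hS, c', hc', hdec⟩ := hdec
  set P := taylorPoly j φ x with hP
  have hPn : P ∈ polys d n := polys_mono hjn (taylorPoly_mem_polys j φ x)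
  -- `P` agrees with its interpolant on a neighbourhood of `x`, so their derivatives at `x`
  -- coincide; those of `P` are those of `φ`.
  have h1 : partialDeriv α φ x = ∑ a, P (S.node a) * partialDeriv α (S.shape a) x := by
    rw [← partialDeriv_taylorPoly hα hφ x, ← partialDeriv_interp hΩ hS P (hα.trans hjr) hx]
    refine partialDeriv_congr ?_
    filter_upwards [hΩ.mem_nhds hx] with y hy
    exact (hcons.interp_eq hPn hy).symm
  rw [partialDeriv_interp hΩ hS φ (hα.trans hjr) hx, h1, ← Finset.sum_sub_distrib]
  refine (Finset.abs_sum_le_sum_abs _ _).trans ?_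
  -- Rescaling by `h` turns the density bound for balls of radius `h` into one for unit balls.
  set z : I → E d := fun a => h⁻¹ • (S.node a - x) with hz
  have hzn (a) : ‖z a‖ = ‖x - S.node a‖ / h := by
    rw [hz, norm_smul, norm_inv, Real.norm_of_nonneg hh.le, norm_sub_rev]
    ring
  have hzd (y) : (Nat.card {a // z a ∈ Metric.closedBall y 1} : ℝ) ≤ τ := by
    refine le_trans (le_of_eq ?_) (hdens (x + h • y))
    congr 1
    refine Nat.card_congr (Equiv.subtypeEquivRight fun a => ?_)
    simp only [mem_closedBall_iff_norm]
    have : S.node a - (x + h • y) = h • (z a - y) := by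
      rw [hz, smul_sub, smul_inv_smul₀ hh.ne']
      abel
    rw [this, norm_smul, Real.norm_of_nonneg hh.le, mul_le_iff_le_one_right hh]
  have hρ : (d : ℝ) < 2 * s - (j + 1 : ℕ) := by
    push_cast
    linarith
  have hsum := sum_node_decay_le z hρ hzd
  have hterm (a : I) : |φ (S.node a) * partialDeriv α (S.shape a) x -
      P (S.node a) * partialDeriv α (S.shape a) x| ≤
      M * c * 2 ^ s * h * (1 + ‖z a‖) ^ (-(2 * s - (j + 1 : ℕ))) := by
    rw [← sub_mul, abs_mul]
    have e1 : |φ (S.node a) - P (S.node a)| ≤ M * (h * ‖z a‖) ^ (j + 1) := by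
      have := abs_sub_taylorPoly_le hφ hM x (S.node a)
      rwa [norm_sub_rev, show ‖x - S.node a‖ = h * ‖z a‖ by rw [hzn]; field_simp] at this
    have hA : 0 < (1 + ‖z a‖ ^ 2) ^ s := by positivity
    have e2 : |partialDeriv α (S.shape a) x| ≤ c / ((1 + ‖z a‖ ^ 2) ^ s * h ^ α.degree) := by
      rw [le_div_iff₀ (by positivity), mul_comm]
      rw [hzn]
      exact (hdec α (hα.trans hjr) x hx a).trans hc'.le
    -- The Taylor order exceeds `|α|` by at least one, which leaves a factor `h`, as `h ≤ 1`.
    have e3 : h ^ (j + 1) / h ^ α.degree ≤ h := by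
      rw [div_le_iff₀ (by positivity), pow_succ, mul_comm]
      exact mul_le_mul_of_nonneg_left (pow_le_pow_of_le_one hh.le hh1 hα) hh.le
    calc _ ≤ (M * (h * ‖z a‖) ^ (j + 1)) * (c / ((1 + ‖z a‖ ^ 2) ^ s * h ^ α.degree)) := by
          gcongr
      _ = M * c * (h ^ (j + 1) / h ^ α.degree) * (‖z a‖ ^ (j + 1) / (1 + ‖z a‖ ^ 2) ^ s) := by
          rw [mul_pow]
          field_simp
      _ ≤ M * c * h * (2 ^ s * (1 + ‖z a‖) ^ (-(2 * s - (j + 1 : ℕ)))) := by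
          gcongr
          exact pow_mul_rpow_neg_le hs0 (norm_nonneg _) (j + 1)
      _ = _ := by ring
  calc _ ≤ ∑ a, M * c * 2 ^ s * h * (1 + ‖z a‖) ^ (-(2 * s - (j + 1 : ℕ))) :=
        Finset.sum_le_sum fun a _ => hterm a
    _ = M * c * 2 ^ s * h * ∑ a, (1 + ‖z a‖) ^ (-(2 * s - (j + 1 : ℕ))) := by
        rw [Finset.mul_sum]
    _ ≤ M * c * 2 ^ s * h * (nodeSumConst d (2 * s - (j + 1 : ℕ)) * τ) := by gcongr
    _ = _ := by ring

end ApproximationScheme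

/-! ### Mollification -/

/-- The convolution of `f` with a kernel `η`. -/
noncomputable def mollify (f η : E d → ℝ) (x : E d) : ℝ := ∫ z, f z * η (x - z)

theorem mollify_eq_convolution (f η : E d → ℝ) :
    mollify f η = convolution f η (ContinuousLinearMap.mul ℝ ℝ) volume := rfl

theorem contDiff_mollify {f η : E d → ℝ} (hf : LocallyIntegrable f) (hη : ContDiff ℝ ∞ η)
    (hc : HasCompactSupport η) : ContDiff ℝ ∞ (mollify f η) :=
  hc.contDiff_convolution_right (ContinuousLinearMap.mul ℝ ℝ) hf hη

/-- All derivatives fall on the smooth kernel, so `f` need only be locally integrable. -/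
theorem iteratedFDeriv_mollify {f η : E d → ℝ} (hf : LocallyIntegrable f) (hη : ContDiff ℝ ∞ η)
    (hc : HasCompactSupport η) {k : ℕ} (m : Fin k → E d) (x : E d) :
    iteratedFDeriv ℝ k (mollify f η) x m = mollify f (fun y => iteratedFDeriv ℝ k η y m) x := by
  induction k generalizing x with
  | zero => simp
  | succ k ih =>
    have hk : ContDiff ℝ ∞ (iteratedFDeriv ℝ k η) :=
      hη.iteratedFDeriv_right (by exact_mod_cast le_top)
    have hk' : ContDiff ℝ ∞ (iteratedFDeriv ℝ k (mollify f η)) :=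
      (contDiff_mollify hf hη hc).iteratedFDeriv_right (by exact_mod_cast le_top)
    set ψ : E d → ℝ := fun y => iteratedFDeriv ℝ k η y (Fin.tail m) with hψ_def
    have hψ : ContDiff ℝ ∞ ψ := (ContinuousMultilinearMap.apply ℝ (fun _ : Fin k => E d) ℝ
      (Fin.tail m)).contDiff.comp hk
    have hψc : HasCompactSupport ψ := (hc.iteratedFDeriv (𝕜 := ℝ) k).comp_left
      (g := fun M : ContinuousMultilinearMap ℝ (fun _ : Fin k => E d) ℝ => M (Fin.tail m)) rfl
    have h1 : ∀ (g : E d → ℝ), ContDiff ℝ ∞ (iteratedFDeriv ℝ k g) → ∀ y,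
        iteratedFDeriv ℝ (k + 1) g y m =
          fderiv ℝ (fun y => iteratedFDeriv ℝ k g y (Fin.tail m)) y (m 0) := by
      intro g hg y
      rw [((hg.differentiable (by simp) y).hasFDerivAt.continuousMultilinear_apply_const
        (Fin.tail m)).fderiv, iteratedFDeriv_succ_apply_left]
      rfl
    have h2 : (fun y => iteratedFDeriv ℝ k (mollify f η) y (Fin.tail m)) = mollify f ψ :=
      funext fun y => ih _ _
    rw [h1 _ hk' x, h2, mollify_eq_convolution,
      (hψc.hasFDerivAt_convolution_right (ContinuousLinearMap.mul ℝ ℝ) hf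
        (hψ.of_le (by exact_mod_cast le_top)) x).fderiv,
      convolution_precompR_apply _ hf (hψc.fderiv ℝ) (hψ.continuous_fderiv (by simp))]
    simp only [h1 η hk]
    rfl

theorem partialDeriv_mollify {f η : E d → ℝ} (hf : LocallyIntegrable f) (hη : ContDiff ℝ ∞ η)
    (hc : HasCompactSupport η) (α : MultiIndex d) (x : E d) :
    partialDeriv α (mollify f η) x = mollify f (partialDeriv α η) x :=
  iteratedFDeriv_mollify hf hη hc (dirs α) x

/-- Derivatives of mollifications are mollifications of weak derivatives, at points whose distance
from the complement is larger than the radius of the kernel. -/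
theorem HasWeakDeriv.partialDeriv_mollify_indicator {Ω : Set (E d)} (hΩ : IsOpen Ω)
    {α : MultiIndex d} {u v : E d → ℝ} (h : HasWeakDeriv Ω α u v)
    (hu : Integrable u (volume.restrict Ω)) {η : E d → ℝ} (hη : ContDiff ℝ ∞ η)
    {ε : ℝ} (hs : tsupport η ⊆ Metric.closedBall 0 ε) {x : E d}
    (hx : Metric.closedBall x ε ⊆ Ω) :
    partialDeriv α (mollify (Ω.indicator u) η) x = mollify (Ω.indicator v) η x := by
  have hc : HasCompactSupport η :=
    (isCompact_closedBall _ _).of_isClosed_subset isClosed_closure hs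
  have hui : Integrable (Ω.indicator u) := (integrable_indicator_iff hΩ.measurableSet).2 hu
  rw [partialDeriv_mollify hui.locallyIntegrable hη hc]
  have hind (w ψ : E d → ℝ) : mollify (Ω.indicator w) ψ x = ∫ z in Ω, w z * ψ (x - z) := by
    rw [mollify, ← integral_indicator hΩ.measurableSet]
    congr 1
    funext z
    by_cases hz : z ∈ Ω <;> simp [hz]
  rw [hind, hind]
  have hsupp : tsupport (fun z => η (x - z)) ⊆ Metric.closedBall x ε := by
    refine closure_minimal (fun z hz => ?_) Metric.isClosed_closedBall
    have := hs (subset_tsupport _ hz)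
    rw [mem_closedBall_zero_iff] at this
    rwa [mem_closedBall_iff_norm, norm_sub_rev]
  -- The reflected kernel is an admissible test function because its support lies in `Ω`. The sign
  -- from the reflection cancels the one in the definition of weak derivatives.
  have key := h.2.2 (fun z => η (x - z)) (hη.comp (by fun_prop))
    ((isCompact_closedBall _ _).of_isClosed_subset isClosed_closure hsupp) (hsupp.trans hx)
  simp only [partialDeriv_comp_const_sub hη] at key
  have h2 : ∫ z in Ω, u z * ((-1) ^ α.degree * partialDeriv α η (x - z)) =
      (-1) ^ α.degree * ∫ z in Ω, u z * partialDeriv α η (x - z) := by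
    rw [← integral_const_mul]
    congr 1
    funext z
    ring
  rw [h2] at key
  exact mul_left_cancel₀ (pow_ne_zero _ (by norm_num)) key

/-! ### Convergence in `L^p` -/

/-- Translations are continuous in `L^p`. -/
theorem exists_eLpNorm_translate_sub_le {p : ℝ≥0∞} (hp : 1 ≤ p) (hp' : p ≠ ⊤) {f : E d → ℝ}
    (hf : MemLp f p) {δ : ℝ≥0∞} (hδ : 0 < δ) :
    ∃ ρ > 0, ∀ a : E d, ‖a‖ < ρ → eLpNorm (fun x => f (x + a) - f x) p ≤ δ := by
  have : Fact (1 ≤ p) := ⟨hp⟩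
  let g : E d → C(E d, E d) := fun a => ⟨fun x => x + a, by fun_prop⟩
  have hg : Continuous g := ContinuousMap.continuous_of_continuous_uncurry _ (by
    show Continuous fun q : E d × E d => q.2 + q.1
    fun_prop)
  have hgm (a) : MeasurePreserving (g a) (volume : Measure (E d)) volume :=
    measurePreserving_add_right volume a
  have hcont := Continuous.compMeasurePreservingLp (f := fun _ : E d => hf.toLp f)
    continuous_const hg hgm hp'
  have ht := (hcont.tendsto 0)
  rw [EMetric.tendsto_nhds] at ht
  obtain ⟨ρ, hρ, h⟩ := Metric.eventually_nhds_iff.1 (ht δ hδ)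
  refine ⟨ρ, hρ, fun a ha => ?_⟩
  have h1 := h (y := a) (by simpa using ha)
  rw [Lp.edist_def] at h1
  refine le_of_eq_of_le (eLpNorm_congr_ae ?_) h1.le
  have e1 (b : E d) : ⇑(Lp.compMeasurePreserving (g b) (hgm b) (hf.toLp f)) =ᵐ[volume]
      fun x => f (x + b) :=
    (Lp.coeFn_compMeasurePreserving _ (hgm b)).trans
      ((hgm b).quasiMeasurePreserving.ae_eq_comp hf.coeFn_toLp)
  filter_upwards [e1 a, e1 0] with x h1 h2
  rw [Pi.sub_apply, h1, h2, add_zero]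

/-- An average of functions with bounded `L^p` norm has bounded `L^p` norm. -/
theorem eLpNorm_integral_le {p : ℝ≥0∞} (hp : 1 ≤ p) (hp' : p ≠ ⊤) {ν : Measure (E d)}
    [IsProbabilityMeasure ν] {F : E d → E d → ℝ} (hF : StronglyMeasurable (Function.uncurry F))
    {δ : ℝ≥0∞} (hδ : ∀ᵐ w ∂ν, eLpNorm (fun x => F x w) p ≤ δ) :
    eLpNorm (fun x => ∫ w, F x w ∂ν) p ≤ δ := by
  have hp0 : p ≠ 0 := (zero_lt_one.trans_le hp).ne'
  have hq : 0 < p.toReal := ENNReal.toReal_pos hp0 hp'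
  have hmeas : Measurable (Function.uncurry fun x w => ‖F x w‖ₑ ^ p.toReal) :=
    hF.measurable.enorm.pow_const _
  have hpow (g : E d → ℝ) (μ : Measure (E d)) :
      eLpNorm g p μ ^ p.toReal = ∫⁻ x, ‖g x‖ₑ ^ p.toReal ∂μ := by
    rw [eLpNorm_eq_lintegral_rpow_enorm_toReal hp0 hp', ← ENNReal.rpow_mul,
      one_div_mul_cancel hq.ne', ENNReal.rpow_one]
  -- Jensen's inequality, obtained from the monotonicity of `L^q` norms for a probability measure;
  -- Tonelli then finishes.
  have h1 (x) : ‖∫ w, F x w ∂ν‖ₑ ^ p.toReal ≤ ∫⁻ w, ‖F x w‖ₑ ^ p.toReal ∂ν := by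
    rw [← hpow (F x) ν]
    gcongr
    refine (enorm_integral_le_lintegral_enorm _).trans ?_
    rw [← eLpNorm_one_eq_lintegral_enorm]
    exact eLpNorm_le_eLpNorm_of_exponent_le hp
      (hF.comp_measurable measurable_prodMk_left).aestronglyMeasurable
  rw [← ENNReal.rpow_le_rpow_iff hq, hpow]
  calc ∫⁻ x, ‖∫ w, F x w ∂ν‖ₑ ^ p.toReal ≤ ∫⁻ x, ∫⁻ w, ‖F x w‖ₑ ^ p.toReal ∂ν :=
        lintegral_mono h1
    _ = ∫⁻ w, ∫⁻ x, ‖F x w‖ₑ ^ p.toReal ∂volume ∂ν := lintegral_lintegral_swap hmeas.aemeasurable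
    _ = ∫⁻ w, eLpNorm (fun x => F x w) p ^ p.toReal ∂ν := by simp only [hpow]
    _ ≤ ∫⁻ _, δ ^ p.toReal ∂ν := by
        refine lintegral_mono_ae ?_
        filter_upwards [hδ] with w hw
        gcongr
    _ = δ ^ p.toReal := by simp

/-- A mollification followed by a small translation is close to the identity in `L^p`. -/
theorem exists_eLpNorm_mollify_sub_le {p : ℝ≥0∞} (hp : 1 ≤ p) (hp' : p ≠ ⊤) {f : E d → ℝ}
    (hf : MemLp f p) (hfi : Integrable f) {δ : ℝ≥0∞} (hδ : 0 < δ) :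
    ∃ ρ > 0, ∀ (a : E d) (φ : ContDiffBump (0 : E d)), ‖a‖ < ρ → φ.rOut < ρ →
      eLpNorm (fun x => mollify f (φ.normed volume) (x + a) - f x) p ≤ δ := by
  -- A strongly measurable representative makes `g (x + a - w)` jointly measurable in `x` and `w`.
  set g := hf.1.mk f with hg_def
  have hfg : f =ᵐ[volume] g := hf.1.ae_eq_mk
  have hgm : StronglyMeasurable g := hf.1.stronglyMeasurable_mk
  have hg : MemLp g p := hf.ae_eq hfg
  have hgi : Integrable g := hfi.congr hfg
  obtain ⟨ρ, hρ, h⟩ := exists_eLpNorm_translate_sub_le hp hp' hg hδ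
  -- Translation and mollification together shift by `a - w`, so each may use half of `ρ`.
  refine ⟨ρ / 2, half_pos hρ, fun a φ ha hφ => ?_⟩
  set η := φ.normed volume with hη
  have hη0 (w) : 0 ≤ η w := φ.nonneg_normed w
  have hηm : Measurable η := φ.continuous_normed.measurable
  -- With respect to this probability measure the error is an average of translation errors of `g`.
  set ν : Measure (E d) := volume.withDensity fun w => ENNReal.ofReal (η w) with hν
  have hprob : IsProbabilityMeasure ν := ⟨by
    rw [hν, withDensity_apply _ MeasurableSet.univ, Measure.restrict_univ,
      ← ofReal_integral_eq_lintegral_ofReal φ.integrable_normed (Eventually.of_forall hη0),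
      φ.integral_normed, ENNReal.ofReal_one]⟩
  have hνint (G : E d → ℝ) : ∫ w, G w ∂ν = ∫ w, η w * G w := by
    rw [hν, integral_withDensity_eq_integral_toReal_smul (by fun_prop)
      (Eventually.of_forall fun _ => ENNReal.ofReal_lt_top)]
    simp only [ENNReal.toReal_ofReal (hη0 _), smul_eq_mul]
  obtain ⟨C, hC⟩ := φ.continuous_normed.bounded_above_of_compact_support
    (φ.hasCompactSupport_normed (μ := volume))
  have hνi (x : E d) : Integrable (fun w => g (x + a - w)) ν := by
    rw [hν, integrable_withDensity_iff_integrable_smul' (by fun_prop)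
      (Eventually.of_forall fun _ => ENNReal.ofReal_lt_top)]
    simp only [ENNReal.toReal_ofReal (hη0 _)]
    exact (hgi.comp_sub_left (x + a)).bdd_mul φ.continuous_normed.aestronglyMeasurable
      (Eventually.of_forall hC)
  have hrep (x : E d) : mollify f η (x + a) - g x = ∫ w, (g (x + a - w) - g x) ∂ν := by
    rw [integral_sub (hνi x) (integrable_const _), hνint]
    simp only [integral_const, probReal_univ, one_smul]
    congr 1
    have e1 : mollify f η (x + a) = ∫ z, g z * η (x + a - z) := by
      refine integral_congr_ae ?_
      filter_upwards [hfg] with z hz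
      rw [hz]
    rw [e1, ← integral_sub_left_eq_self (fun w => η w * g (x + a - w)) volume (x + a)]
    congr 1
    funext z
    rw [sub_sub_cancel, mul_comm]
  have hcongr : (fun x => mollify f η (x + a) - f x) =ᵐ[volume]
      fun x => ∫ w, (g (x + a - w) - g x) ∂ν := by
    filter_upwards [hfg] with x hx
    rw [hx, hrep]
  rw [eLpNorm_congr_ae hcongr]
  refine eLpNorm_integral_le hp hp' (F := fun x w => g (x + a - w) - g x) ?_ ?_
  · exact (hgm.comp_measurable (by fun_prop : Measurable fun q : E d × E d => q.1 + a - q.2)).sub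
      (hgm.comp_measurable measurable_fst)
  · have hae : ∀ᵐ w ∂ν, w ∈ Function.support η := by
      rw [hν, ae_withDensity_iff (by fun_prop)]
      refine Eventually.of_forall fun w hw => ?_
      intro h0
      simp [h0] at hw
    filter_upwards [hae] with w hw
    have hw' : ‖w‖ < ρ / 2 := by
      rw [hη, φ.support_normed_eq, mem_ball_zero_iff] at hw
      exact hw.trans hφ
    have := h (a - w) ((norm_sub_le _ _).trans_lt (by linarith))
    simpa only [add_sub_assoc] using this

/-! ### Density of smooth functions -/

/-- Under the segment condition the closure of a bounded set is covered by finitely many patches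
that can be translated into the set, with a subordinate smooth partition of unity. -/
theorem SegmentCondition.exists_partition {Ω : Set (E d)} (hΩ : IsOpen Ω)
    (hb : Bornology.IsBounded Ω) (hseg : SegmentCondition Ω) :
    ∃ (s : Finset (E d)) (ψ : s → E d → ℝ) (y : s → E d),
      (∀ i, ContDiff ℝ ∞ (ψ i)) ∧ (∀ i, HasCompactSupport (ψ i)) ∧
      (∀ i, ∀ z ∈ closure Ω ∩ tsupport (ψ i), ∀ t : ℝ, 0 < t → t < 1 → z + t • y i ∈ Ω) ∧
      ∀ x ∈ closure Ω, ∑ i, ψ i x = 1 := by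
  have hloc : ∀ x ∈ closure Ω, ∃ U, IsOpen U ∧ x ∈ U ∧ ∃ y : E d, Bornology.IsBounded U ∧
      ∀ z ∈ closure Ω ∩ U, ∀ t : ℝ, 0 < t → t < 1 → z + t • y ∈ Ω := by
    intro x hx
    by_cases hxΩ : x ∈ Ω
    -- Points of `Ω` need no translation: the patch is `Ω` itself and the vector is zero.
    · exact ⟨Ω, hΩ, hxΩ, 0, hb, fun z hz t _ _ => by simpa using hz.2⟩
    · obtain ⟨U, hU, y, -, h⟩ := hseg x ⟨hx, by rwa [hΩ.interior_eq]⟩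
      refine ⟨interior U ∩ Metric.ball x 1, isOpen_interior.inter Metric.isOpen_ball,
        ⟨mem_interior_iff_mem_nhds.2 hU, Metric.mem_ball_self one_pos⟩, y,
        Metric.isBounded_ball.subset inter_subset_right, fun z hz => h z ⟨hz.1, ?_⟩⟩
      exact interior_subset hz.2.1
  choose! U hUo hxU y hUb hy using hloc
  have hcomp : IsCompact (closure Ω) := hb.isCompact_closure
  obtain ⟨s, hcov⟩ := hcomp.elim_nhds_subcover' (fun x _ => U x)
    fun x hx => (hUo x hx).mem_nhds (hxU x hx)
  classical
  let s' : Finset (E d) := s.image Subtype.val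
  have hs' : ∀ i : s', (i : E d) ∈ closure Ω := by
    rintro ⟨i, hi⟩
    obtain ⟨a, -, rfl⟩ := Finset.mem_image.1 hi
    exact a.2
  obtain ⟨f, hf⟩ := SmoothPartitionOfUnity.exists_isSubordinate
    (modelWithCornersSelf ℝ (E d)) isClosed_closure (fun i : s' => U i)
    (fun i => hUo i (hs' i)) (by
      intro x hx
      obtain ⟨a, ha, hxa⟩ := mem_iUnion₂.1 (hcov hx)
      exact mem_iUnion.2 ⟨⟨a, Finset.mem_image_of_mem _ ha⟩, hxa⟩)
  refine ⟨s', fun i => f i, fun i => y i, fun i => (f i).contMDiff.contDiff, fun i => ?_,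
    fun i z hz => hy i (hs' i) z ⟨hz.1, hf i hz.2⟩, fun x hx => ?_⟩
  · exact Metric.isCompact_of_isClosed_isBounded isClosed_closure
      ((hUb i (hs' i)).subset (hf i))
  · rw [← f.sum_eq_one hx, finsum_eq_sum_of_fintype]

/-- Approximation on a patch that can be translated into the set. -/
theorem exists_contDiff_approx_on_patch {Ω : Set (E d)} (hΩ : IsOpen Ω)
    (hb : Bornology.IsBounded Ω) {p : ℝ≥0∞} (hp : 1 ≤ p) (hp' : p ≠ ⊤) {j : ℕ} {u : E d → ℝ}
    {v : MultiIndex d → E d → ℝ} (hu : MemLp u p (volume.restrict Ω))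
    (hv : ∀ α ∈ multiIndices d j, HasWeakDeriv Ω α u (v α) ∧ MemLp (v α) p (volume.restrict Ω))
    {K : Set (E d)} (hK : IsCompact K) {y : E d}
    (hy : ∀ z ∈ closure Ω ∩ K, ∀ t : ℝ, 0 < t → t < 1 → z + t • y ∈ Ω)
    {δ : ℝ≥0∞} (hδ : 0 < δ) :
    ∃ g : E d → ℝ, ContDiff ℝ ∞ g ∧ ∀ α ∈ multiIndices d j,
      eLpNorm (K.indicator fun x => partialDeriv α g x - v α x) p (volume.restrict Ω) ≤ δ := by
  have hev : ∀ᶠ ρ : ℝ in 𝓝[>] 0, ∀ α ∈ multiIndices d j, ∀ (a : E d)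
      (φ : ContDiffBump (0 : E d)), ‖a‖ < ρ → φ.rOut < ρ →
      eLpNorm (fun x => mollify (Ω.indicator (v α)) (φ.normed volume) (x + a) -
        Ω.indicator (v α) x) p ≤ δ := by
    rw [Finset.eventually_all]
    intro α hα
    obtain ⟨ρ, hρ, h⟩ := exists_eLpNorm_mollify_sub_le hp hp'
      ((memLp_indicator_iff_restrict hΩ.measurableSet).2 (hv α hα).2)
      ((integrable_indicator_iff hΩ.measurableSet).2
        (MemLp.integrable_of_isBounded hb hp (hv α hα).2)) hδ
    filter_upwards [Ioc_mem_nhdsGT hρ] with ρ' hρ' a φ ha hφ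
    exact h a φ (ha.trans_le hρ'.2) (hφ.trans_le hρ'.2)
  obtain ⟨ρ, hρ, hρ0⟩ := (hev.and self_mem_nhdsWithin).exists
  replace hρ0 : 0 < ρ := hρ0
  obtain ⟨t, ht0, ht1, hty⟩ : ∃ t : ℝ, 0 < t ∧ t < 1 ∧ ‖t • y‖ < ρ := by
    -- The summand `1` covers patches with `y = 0`.
    refine ⟨min (1 / 2) (ρ / (2 * (‖y‖ + 1))), by positivity,
      (min_le_left _ _).trans_lt (by norm_num), ?_⟩
    rw [norm_smul, Real.norm_of_nonneg (by positivity)]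
    calc min (1 / 2) (ρ / (2 * (‖y‖ + 1))) * ‖y‖ ≤ ρ / (2 * (‖y‖ + 1)) * (‖y‖ + 1) := by
          gcongr
          · exact min_le_right _ _
          · linarith
      _ = ρ / 2 := by field_simp
      _ < ρ := half_lt_self hρ0
  -- The pushed patch is compact in `Ω`, hence at positive distance from the complement, and the
  -- kernel radius is chosen below that distance.
  have hcomp : IsCompact ((fun z => z + t • y) '' (closure Ω ∩ K)) :=
    (hK.inter_left isClosed_closure).image (by fun_prop)
  obtain ⟨ε, hε, hsub⟩ := hcomp.exists_cthickening_subset_open hΩ (by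
    rintro _ ⟨z, hz, rfl⟩
    exact hy z hz t ht0 ht1)
  let φ : ContDiffBump (0 : E d) := ⟨min ε (ρ / 2) / 2, min ε (ρ / 2), by positivity,
    half_lt_self (by positivity)⟩
  have hφε : φ.rOut ≤ ε := min_le_left _ _
  have hφρ : φ.rOut < ρ := (min_le_right _ _).trans_lt (half_lt_self hρ0)
  set η := φ.normed (volume : Measure (E d)) with hη
  have hηs : ContDiff ℝ ∞ η := φ.contDiff_normed
  have hui := MemLp.integrable_of_isBounded hb hp hu
  have huI : LocallyIntegrable (Ω.indicator u) :=
    ((integrable_indicator_iff hΩ.measurableSet).2 hui).locallyIntegrable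
  refine ⟨fun x => mollify (Ω.indicator u) η (x + t • y),
    (contDiff_mollify huI hηs φ.hasCompactSupport_normed).comp (by fun_prop), fun α hα => ?_⟩
  refine le_trans ?_ ((eLpNorm_mono_measure _ (Measure.restrict_le_self (s := Ω))).trans
    (hρ α hα (t • y) φ hty hφρ))
  refine eLpNorm_mono_ae ?_
  filter_upwards [ae_restrict_mem hΩ.measurableSet] with x hx
  by_cases hxK : x ∈ K
  · rw [indicator_of_mem hxK, partialDeriv_comp_add_right, indicator_of_mem hx,
      (hv α hα).1.partialDeriv_mollify_indicator hΩ hui hηs (ε := φ.rOut)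
        φ.tsupport_normed_eq.le]
    have hmem : x + t • y ∈ (fun z => z + t • y) '' (closure Ω ∩ K) :=
      ⟨x, ⟨subset_closure hx, hxK⟩, rfl⟩
    exact ((Metric.closedBall_subset_closedBall hφε).trans
      (Metric.closedBall_subset_cthickening hmem ε)).trans hsub
  · rw [indicator_of_notMem hxK, norm_zero]
    exact norm_nonneg _

/-- Gluing with a partition of unity: the error in the derivatives of `∑ ψ_i g_i` at a point is
bounded by the errors in the derivatives of those `g_i` for which the point is in the support
of `ψ_i`. -/
theorem abs_partialDeriv_glue_sub_le {ι : Type*} [Fintype ι] {j : ℕ} {ψ g : ι → E d → ℝ}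
    (hψ : ∀ i, ContDiff ℝ ∞ (ψ i)) (hg : ∀ i, ContDiff ℝ ∞ (g i)) {B : ℝ}
    (hB : ∀ i, ∀ k ≤ j, ∀ x, ‖iteratedFDeriv ℝ k (ψ i) x‖ ≤ B) {x : E d}
    (hsum : ∀ᶠ y in 𝓝 x, ∑ i, ψ i y = 1) (v : MultiIndex d → ℝ) {α : MultiIndex d}
    (hα : α ∈ multiIndices d j) :
    |partialDeriv α (fun y => ∑ i, ψ i y * g i y) x - v α| ≤
      (2 ^ j * B * (d + 1) ^ j * (1 + Fintype.card ι) + 1) *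
        ∑ i, ∑ β ∈ multiIndices d j,
          |(tsupport (ψ i)).indicator (fun y => partialDeriv β (g i) y - v β) x| := by
  classical
  have hα' := mem_multiIndices.1 hα
  set e : ι → ℝ := fun i => ∑ β ∈ multiIndices d j,
    |(tsupport (ψ i)).indicator (fun y => partialDeriv β (g i) y - v β) x| with he
  have he0 (i) : 0 ≤ e i := Finset.sum_nonneg fun _ _ => abs_nonneg _
  obtain ⟨i₀, hi₀⟩ : ∃ i, ψ i x ≠ 0 := by
    by_contra! h
    simpa [h] using hsum.self_of_nhds
  have hB0 : 0 ≤ B := (norm_nonneg _).trans (hB i₀ 0 (Nat.zero_le _) 0)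
  have hmem (i) (hi : x ∈ tsupport (ψ i)) :
      e i = ∑ β ∈ multiIndices d j, |partialDeriv β (g i) x - v β| := by
    simp only [he, indicator_of_mem hi]
  have hx₀ := hmem i₀ (subset_tsupport _ hi₀)
  have hcd (n : ℕ) {f : E d → ℝ} (hf : ContDiff ℝ ∞ f) : ContDiffAt ℝ n f x :=
    (hf.of_le (by exact_mod_cast le_top)).contDiffAt
  have hdiff (i) : ContDiff ℝ ∞ (fun y => g i y - g i₀ y) := (hg i).sub (hg i₀)
  have hprod (i) : ContDiff ℝ ∞ (fun y => ψ i y * (g i y - g i₀ y)) := (hψ i).mul (hdiff i)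
  -- Near `x`, `∑ ψ_i g_i = ∑ ψ_i (g_i - g_{i₀}) + g_{i₀}`. The Leibniz rule is thus applied to
  -- smooth differences only, and the numbers `v β` enter by the triangle inequality; no product
  -- rule for weak derivatives is needed.
  have hrep : partialDeriv α (fun y => ∑ i, ψ i y * g i y) x =
      ∑ i, partialDeriv α (fun y => ψ i y * (g i y - g i₀ y)) x + partialDeriv α (g i₀) x := by
    rw [← partialDeriv_sum fun i _ => hcd _ (hprod i),
      ← partialDeriv_add (hcd _ (ContDiff.sum fun i _ => hprod i)) (hcd _ (hg i₀))]
    refine partialDeriv_congr ?_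
    filter_upwards [hsum] with y hy
    simp only [mul_sub, Finset.sum_sub_distrib, ← Finset.sum_mul, hy]
    ring
  set C : ℝ := 2 ^ j * B * (d + 1) ^ j with hC
  have hC0 : 0 ≤ C := by positivity
  have hterm (i) : |partialDeriv α (fun y => ψ i y * (g i y - g i₀ y)) x| ≤ C * (e i + e i₀) := by
    by_cases hi : x ∈ tsupport (ψ i)
    · have hS : ∑ β ∈ multiIndices d j, |partialDeriv β (fun y => g i y - g i₀ y) x| ≤
          e i + e i₀ := by
        rw [hmem i hi, hx₀, ← Finset.sum_add_distrib]
        refine Finset.sum_le_sum fun β _ => ?_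
        rw [partialDeriv_sub (hcd _ (hg i)) (hcd _ (hg i₀))]
        have := abs_sub_le (partialDeriv β (g i) x) (v β) (partialDeriv β (g i₀) x)
        rwa [abs_sub_comm (v β)] at this
      refine (abs_partialDeriv_le _ _ _).trans ((norm_iteratedFDeriv_mul_le (hψ i) (hdiff i) x
        (n := α.degree) (by exact_mod_cast le_top)).trans ?_)
      have hk : ∀ k ∈ Finset.range (α.degree + 1), (α.degree.choose k : ℝ) *
          ‖iteratedFDeriv ℝ k (ψ i) x‖ *
          ‖iteratedFDeriv ℝ (α.degree - k) (fun y => g i y - g i₀ y) x‖ ≤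
          (α.degree.choose k : ℝ) * (B * ((d + 1) ^ j * (e i + e i₀))) := by
        intro k hk
        have hkα : k ≤ α.degree := Nat.lt_succ_iff.1 (Finset.mem_range.1 hk)
        rw [mul_assoc]
        gcongr
        · exact hB i k (hkα.trans hα') x
        · refine (norm_iteratedFDeriv_le_sum_partialDeriv (j := j)
            ((Nat.sub_le _ _).trans hα') (hdiff i) x).trans ?_
          gcongr
          calc (d : ℝ) ^ (α.degree - k) ≤ (d + 1) ^ (α.degree - k) := by
                gcongr
                linarith
            _ ≤ (d + 1) ^ j := pow_le_pow_right₀ (by linarith [(Nat.cast_nonneg d : (0:ℝ) ≤ d)])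
                ((Nat.sub_le _ _).trans hα')
      refine (Finset.sum_le_sum hk).trans ?_
      rw [← Finset.sum_mul]
      have h2 : ∑ k ∈ Finset.range (α.degree + 1), (α.degree.choose k : ℝ) = 2 ^ α.degree := by
        exact_mod_cast Nat.sum_range_choose α.degree
      rw [h2, hC]
      have h3 : (2 : ℝ) ^ α.degree ≤ 2 ^ j := pow_le_pow_right₀ (by norm_num) hα'
      have := he0 i
      have := he0 i₀
      calc (2 : ℝ) ^ α.degree * (B * ((d + 1) ^ j * (e i + e i₀)))
          ≤ 2 ^ j * (B * ((d + 1) ^ j * (e i + e i₀))) := by gcongr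
        _ = _ := by ring
    · have h0 : (fun y => ψ i y * (g i y - g i₀ y)) =ᶠ[𝓝 x] fun _ => 0 := by
        filter_upwards [notMem_tsupport_iff_eventuallyEq.1 hi] with y hy
        simp [hy]
      rw [partialDeriv_congr h0, partialDeriv_eq, iteratedFDeriv_fun_zero]
      have := he0 i
      have := he0 i₀
      simp only [Pi.zero_apply, zero_apply, abs_zero]
      positivity
  have hi₀e : |partialDeriv α (g i₀) x - v α| ≤ e i₀ := by
    rw [hx₀]
    exact Finset.single_le_sum (f := fun β => |partialDeriv β (g i₀) x - v β|)
      (fun _ _ => abs_nonneg _) hα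
  have hle : e i₀ ≤ ∑ i, e i :=
    Finset.single_le_sum (f := e) (fun i _ => he0 i) (Finset.mem_univ i₀)
  have hsum0 : 0 ≤ ∑ i, e i := (he0 i₀).trans hle
  rw [hrep, add_sub_assoc]
  calc _ ≤ |∑ i, partialDeriv α (fun y => ψ i y * (g i y - g i₀ y)) x| +
        |partialDeriv α (g i₀) x - v α| := abs_add_le _ _
    _ ≤ ∑ i, C * (e i + e i₀) + e i₀ := by
        gcongr
        exact (Finset.abs_sum_le_sum_abs _ _).trans (Finset.sum_le_sum fun i _ => hterm i)
    _ = C * (∑ i, e i + Fintype.card ι * e i₀) + e i₀ := by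
        rw [← Finset.mul_sum, Finset.sum_add_distrib, Finset.sum_const, Finset.card_univ,
          nsmul_eq_mul]
    _ ≤ C * (∑ i, e i + Fintype.card ι * ∑ i, e i) + ∑ i, e i := by gcongr
    _ = _ := by ring

/-- Functions in `C_c^∞(ℝ^d)` are dense in a Sobolev space over a bounded open set with the segment
condition. -/
theorem exists_contDiff_eLpNorm_partialDeriv_sub_le {Ω : Set (E d)} (hΩ : IsOpen Ω)
    (hb : Bornology.IsBounded Ω) (hseg : SegmentCondition Ω) {p : ℝ≥0∞} (hp : 1 ≤ p)
    (hp' : p ≠ ⊤) {j : ℕ} {u : E d → ℝ}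
    {v : MultiIndex d → E d → ℝ} (hu : MemLp u p (volume.restrict Ω))
    (hv : ∀ α ∈ multiIndices d j, HasWeakDeriv Ω α u (v α) ∧ MemLp (v α) p (volume.restrict Ω))
    {ε : ℝ≥0∞} (hε : 0 < ε) :
    ∃ φ : E d → ℝ, ContDiff ℝ ∞ φ ∧ HasCompactSupport φ ∧ ∀ α ∈ multiIndices d j,
      eLpNorm (fun x => partialDeriv α φ x - v α x) p (volume.restrict Ω) ≤ ε := by
  obtain ⟨s, ψ, y, hψ, hψc, hy, hsum⟩ := hseg.exists_partition hΩ hb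
  obtain ⟨B, hB⟩ : ∃ B : ℝ, ∀ i, ∀ k ≤ j, ∀ x, ‖iteratedFDeriv ℝ k (ψ i) x‖ ≤ B := by
    have h1 (i) (k : ℕ) : ∃ B : ℝ, ∀ x, ‖iteratedFDeriv ℝ k (ψ i) x‖ ≤ B :=
      ((hψ i).continuous_iteratedFDeriv (by exact_mod_cast le_top)).bounded_above_of_compact_support
        ((hψc i).iteratedFDeriv k)
    choose b hb' using h1
    refine ⟨∑ i, ∑ k ∈ Finset.range (j + 1), |b i k|, fun i k hk x => (hb' i k x).trans ?_⟩
    calc b i k ≤ |b i k| := le_abs_self _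
      _ ≤ ∑ k ∈ Finset.range (j + 1), |b i k| :=
        Finset.single_le_sum (f := fun k => |b i k|) (fun _ _ => abs_nonneg _)
          (Finset.mem_range.2 (Nat.lt_succ_iff.2 hk))
      _ ≤ _ := Finset.single_le_sum (f := fun i => ∑ k ∈ Finset.range (j + 1), |b i k|)
          (fun _ _ => Finset.sum_nonneg fun _ _ => abs_nonneg _) (Finset.mem_univ i)
  -- `D` is the constant of the gluing estimate; `C` also counts the pairs of a patch and a
  -- multi-index. Dividing `ε` by `C + 1` avoids a zero denominator.
  set D : ℝ := 2 ^ j * B * (d + 1) ^ j * (1 + Fintype.card s) + 1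
  set C : ℝ≥0∞ := ‖D‖ₑ * (Fintype.card s * (multiIndices d j).card) with hC
  have hCtop : C + 1 ≠ ⊤ := by
    have : C < ⊤ := ENNReal.mul_lt_top enorm_lt_top
      (ENNReal.mul_lt_top (ENNReal.natCast_lt_top _) (ENNReal.natCast_lt_top _))
    exact ENNReal.add_ne_top.2 ⟨this.ne, ENNReal.one_ne_top⟩
  set δ := ε / (C + 1)
  have hδ : 0 < δ := ENNReal.div_pos hε.ne' hCtop
  have hloc (i) := exists_contDiff_approx_on_patch hΩ hb hp hp' hu hv (hψc i).isCompact (hy i) hδ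
  choose g hg hgle using hloc
  refine ⟨fun x => ∑ i, ψ i x * g i x, ContDiff.sum fun i _ => (hψ i).mul (hg i),
    ?_, fun α hα => ?_⟩
  · refine HasCompactSupport.intro (isCompact_iUnion fun i => (hψc i).isCompact) fun x hx => ?_
    refine Finset.sum_eq_zero fun i _ => ?_
    rw [image_eq_zero_of_notMem_tsupport fun h => hx (mem_iUnion.2 ⟨i, h⟩), zero_mul]
  set F : s → MultiIndex d → E d → ℝ := fun i β =>
    (tsupport (ψ i)).indicator fun x => partialDeriv β (g i) x - v β x with hF
  have hFm (i) : ∀ β ∈ multiIndices d j,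
      AEStronglyMeasurable (fun x => |F i β x|) (volume.restrict Ω) := by
    intro β hβ
    exact (((contDiff_partialDeriv β (hg i)).continuous.aestronglyMeasurable.sub
      (hv β hβ).2.1).indicator isClosed_closure.measurableSet).norm
  have hpt : ∀ᵐ x ∂volume.restrict Ω,
      ‖partialDeriv α (fun x => ∑ i, ψ i x * g i x) x - v α x‖ ≤
        ‖D • ∑ i, ∑ β ∈ multiIndices d j, |F i β x|‖ := by
    filter_upwards [ae_restrict_mem hΩ.measurableSet] with x hx
    have hs : ∀ᶠ y in 𝓝 x, ∑ i, ψ i y = 1 := by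
      filter_upwards [hΩ.mem_nhds hx] with y hy'
      exact hsum y (subset_closure hy')
    refine (abs_partialDeriv_glue_sub_le hψ hg hB hs (fun β => v β x) hα).trans ?_
    refine le_trans (le_of_eq ?_) (le_abs_self _)
    simp only [smul_eq_mul]
    congr 1
  calc _ ≤ eLpNorm (fun x => D • ∑ i, ∑ β ∈ multiIndices d j, |F i β x|) p
        (volume.restrict Ω) := eLpNorm_mono_ae hpt
    _ = ‖D‖ₑ * eLpNorm (fun x => ∑ i, ∑ β ∈ multiIndices d j, |F i β x|) p
        (volume.restrict Ω) := eLpNorm_const_smul D _ _ _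
    _ ≤ ‖D‖ₑ * ∑ i : s, ∑ β ∈ multiIndices d j, δ := by
        gcongr
        have e1 : (fun x => ∑ i, ∑ β ∈ multiIndices d j, |F i β x|) =
            ∑ i, ∑ β ∈ multiIndices d j, fun x => |F i β x| := by
          funext x
          simp
        rw [e1]
        refine (eLpNorm_sum_le (fun i _ => ?_) hp).trans (Finset.sum_le_sum fun i _ => ?_)
        · exact Finset.aestronglyMeasurable_sum _ fun β hβ => hFm i β hβ
        · refine (eLpNorm_sum_le (fun β hβ => hFm i β hβ) hp).trans
            (Finset.sum_le_sum fun β hβ => ?_)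
          exact (eLpNorm_norm (F i β)).trans_le (hgle i β hβ)
    _ = C * δ := by
        simp only [Finset.sum_const, Finset.card_univ, nsmul_eq_mul, hC]
        ring
    _ ≤ (C + 1) * δ := by
        gcongr
        exact le_self_add
    _ ≤ ε := ENNReal.mul_div_le

/-! ### Convergence in Sobolev spaces -/

theorem partialDeriv_zero (f : E d → ℝ) : partialDeriv 0 f = f := by
  funext x
  have (k : ℕ) (hk : k = 0) (m : Fin k → E d) : iteratedFDeriv ℝ k f x m = f x := by
    subst hk
    simp
  exact this _ (by simp) _

theorem sobolevNorm_le {Ω : Set (E d)} {j : ℕ} {p : ℝ≥0∞} (hp : 0 < p.toReal) {u : E d → ℝ}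
    {v : MultiIndex d → E d → ℝ} (hv : ∀ α ∈ multiIndices d j, HasWeakDeriv Ω α u (v α))
    {δ : ℝ≥0∞} (hδ : ∀ α ∈ multiIndices d j, eLpNorm (v α) p (volume.restrict Ω) ≤ δ) :
    sobolevNorm Ω j p u ≤ ((multiIndices d j).card : ℝ≥0∞) ^ (1 / p.toReal) * δ := by
  have h : ∑ α ∈ multiIndices d j, weakDerivNorm Ω p α u ^ p.toReal ≤
      (multiIndices d j).card * δ ^ p.toReal := by
    rw [← nsmul_eq_mul]
    refine Finset.sum_le_card_nsmul _ _ _ fun α hα => ?_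
    gcongr
    exact (weakDerivNorm_le (hv α hα)).trans (hδ α hα)
  calc sobolevNorm Ω j p u
      ≤ ((multiIndices d j).card * δ ^ p.toReal) ^ (1 / p.toReal) := by
        rw [sobolevNorm]
        gcongr
    _ = _ := by
        rw [ENNReal.mul_rpow_of_nonneg _ _ (by positivity), ← ENNReal.rpow_mul,
          mul_one_div_cancel hp.ne', ENNReal.rpow_one]

theorem memLp_partialDeriv {Ω : Set (E d)} (hΩ : IsOpen Ω) (hb : Bornology.IsBounded Ω)
    {p : ℝ≥0∞} {α : MultiIndex d} {f : E d → ℝ} (hf : ContDiffOn ℝ α.degree f Ω) {B : ℝ}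
    (hB : ∀ x ∈ Ω, |partialDeriv α f x| ≤ B) :
    MemLp (partialDeriv α f) p (volume.restrict Ω) := by
  have : IsFiniteMeasure (volume.restrict Ω) := isFiniteMeasure_restrict.2 hb.measure_lt_top.ne
  refine MemLp.of_bound
    ((continuousOn_partialDeriv hΩ hf).aestronglyMeasurable hΩ.measurableSet) B ?_
  filter_upwards [ae_restrict_mem hΩ.measurableSet] with x hx using hB x hx

namespace ApproximationScheme

/-- For `s ≥ 0` the decay weight is at least `1`, so the derivatives of the finitely many shape
functions are bounded on the bounded set `Ω`. -/
theorem memLp_partialDeriv_interp {I : Type*} [Fintype I] {S : ApproximationScheme I d}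
    {Ω : Set (E d)} (hΩ : IsOpen Ω) (hb : Bornology.IsBounded Ω) {r : ℕ} {s c h : ℝ}
    (hs : 0 ≤ s) (hh : 0 < h) (hdec : S.HasPolynomialDecay Ω r s c h) (p : ℝ≥0∞) (φ : E d → ℝ)
    {α : MultiIndex d} (hα : α.degree ≤ r) :
    MemLp (partialDeriv α (S.interp φ)) p (volume.restrict Ω) := by
  obtain ⟨hS, c', -, hdec⟩ := hdec
  refine memLp_partialDeriv hΩ hb
    ((contDiffOn_interp hS φ).of_le (by exact_mod_cast hα))
    (B := ∑ a, |φ (S.node a)| * (c' / h ^ α.degree)) fun x hx => ?_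
  rw [partialDeriv_interp hΩ hS φ hα hx]
  refine (Finset.abs_sum_le_sum_abs _ _).trans (Finset.sum_le_sum fun a _ => ?_)
  rw [abs_mul]
  gcongr
  rw [le_div_iff₀ (by positivity)]
  refine le_trans ?_ (hdec α hα x hx a)
  have h1 : (1 : ℝ) ≤ (1 + (‖x - S.node a‖ / h) ^ 2) ^ s :=
    Real.one_le_rpow (by nlinarith [sq_nonneg (‖x - S.node a‖ / h)]) hs
  calc |partialDeriv α (S.shape a) x| * h ^ α.degree
      = 1 * h ^ α.degree * |partialDeriv α (S.shape a) x| := by ring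
    _ ≤ _ := by gcongr

theorem memSobolev_interp {I : Type*} [Fintype I] {S : ApproximationScheme I d}
    {Ω : Set (E d)} (hΩ : IsOpen Ω) (hb : Bornology.IsBounded Ω) {r j : ℕ} (hjr : j ≤ r)
    {s c h : ℝ} (hs : 0 ≤ s) (hh : 0 < h) (hdec : S.HasPolynomialDecay Ω r s c h) (p : ℝ≥0∞)
    (φ : E d → ℝ) : MemSobolev Ω j p (S.interp φ) := by
  refine ⟨?_, fun α hα => ⟨_, hasWeakDeriv_of_contDiffOn hΩ
    ((contDiffOn_interp hdec.1 φ).of_le (by exact_mod_cast hα.trans hjr)),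
    memLp_partialDeriv_interp hΩ hb hs hh hdec p φ (hα.trans hjr)⟩⟩
  have := memLp_partialDeriv_interp hΩ hb hs hh hdec p φ (α := 0)
    (by simp [MultiIndex.degree])
  rwa [partialDeriv_zero] at this

end ApproximationScheme

/-- A sequence of almost minimizers realizes convergence of infima to zero. -/
theorem exists_tendsto_zero_of_eventually_exists_le {X : Type*} [Nonempty X] {N : ℕ → X → ℝ≥0∞}
    (h : ∀ ε > 0, ∀ᶠ k in atTop, ∃ x, N k x ≤ ε) :
    ∃ x : ℕ → X, Tendsto (fun k => N k (x k)) atTop (𝓝 0) := by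
  have hex (k : ℕ) : ∃ x, N k x ≤ (⨅ x, N k x) + (k : ℝ≥0∞)⁻¹ := by
    by_cases htop : ⨅ x, N k x = ⊤
    · exact ⟨Classical.arbitrary X, by simp [htop]⟩
    · have hlt : ⨅ x, N k x < (⨅ x, N k x) + (k : ℝ≥0∞)⁻¹ :=
        ENNReal.lt_add_right htop (ENNReal.inv_ne_zero.2 (ENNReal.natCast_ne_top k))
      obtain ⟨x, hx⟩ := iInf_lt_iff.1 hlt
      exact ⟨x, hx.le⟩
  choose x hx using hex
  refine ⟨x, ENNReal.tendsto_nhds_zero.2 fun ε hε => ?_⟩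
  have hε2 : 0 < ε / 2 := ENNReal.half_pos hε.ne'
  filter_upwards [h _ hε2, ENNReal.tendsto_nhds_zero.1 ENNReal.tendsto_inv_nat_nhds_zero _ hε2]
    with k ⟨y, hy⟩ hk
  calc N k (x k) ≤ (⨅ x, N k x) + (k : ℝ≥0∞)⁻¹ := hx k
    _ ≤ ε / 2 + ε / 2 := add_le_add ((iInf_le _ y).trans hy) hk
    _ = ε := ENNReal.add_halves ε

end Meshfree

/-! ### The approximation theorem -/

theorem mainTheorem3 {d : ℕ} (Ω : Set (Meshfree.E d)) (hΩ_open : IsOpen Ω)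
    (hΩ_bdd : Bornology.IsBounded Ω) (hΩ_seg : Meshfree.SegmentCondition Ω)
    (n r l : ℕ) (s τ c : ℝ) (hτ : 0 < τ) (hc : 0 < c)
    (hl : min n r ≤ l) (hs : (d : ℝ) + (min n l : ℕ) + 1 < 2 * s)
    (I : ℕ → Type*) [∀ k, Fintype (I k)]
    (S : ∀ k, Meshfree.ApproximationScheme (I k) d)
    (h : ℕ → ℝ) (hh_pos : ∀ k, 0 < h k) (hh_lim : Tendsto h atTop (𝓝 0))
    (h_consistent : ∀ k, (S k).IsConsistent Ω n)
    (h_density : ∀ k, (S k).HasDensityBound (h k) τ)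
    (h_decay : ∀ k, (S k).HasPolynomialDecay Ω r s c (h k))
    (p : ℝ≥0∞) (hp_one : 1 ≤ p) (hp_top : p ≠ ⊤)
    (u : Meshfree.E d → ℝ) (hu : Meshfree.MemSobolev Ω (min n r) p u) :
    ∃ v : ℕ → Meshfree.E d → ℝ,
      (∀ k, v k ∈ (S k).space) ∧
      (∀ k, Meshfree.MemSobolev Ω (min n r) p (v k)) ∧
      Tendsto (fun k => Meshfree.sobolevNorm Ω (min n r) p (v k - u)) atTop (𝓝 0) := by
  open Meshfree in
  set j := min n r with hj
  have hjn : j ≤ n := min_le_left _ _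
  have hjr : j ≤ r := min_le_right _ _
  -- The condition `ℓ ≥ j` enters here, through `j ≤ min n l`.
  have hs' : (d : ℝ) + j + 1 < 2 * s := by
    have : (j : ℝ) ≤ (min n l : ℕ) := by exact_mod_cast le_min hjn hl
    linarith
  have hs0 : 0 ≤ s := by
    have : (0 : ℝ) ≤ d := Nat.cast_nonneg d
    have : (0 : ℝ) ≤ j := Nat.cast_nonneg j
    linarith
  have hq : 0 < p.toReal := ENNReal.toReal_pos (zero_lt_one.trans_le hp_one).ne' hp_top
  obtain ⟨hu0, hu1⟩ := hu
  choose! w hw using hu1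
  have hw' : ∀ α ∈ multiIndices d j, HasWeakDeriv Ω α u (w α) ∧
      MemLp (w α) p (volume.restrict Ω) := fun α hα => hw α (mem_multiIndices.1 hα)
  have hfin : IsFiniteMeasure (volume.restrict Ω) :=
    isFiniteMeasure_restrict.2 hΩ_bdd.measure_lt_top.ne
  have key : ∀ ε > 0, ∀ᶠ k in atTop, ∃ φ : E d → ℝ,
      sobolevNorm Ω j p ((S k).interp φ - u) ≤ ε := by
    intro ε hε
    set C : ℝ≥0∞ := ((multiIndices d j).card : ℝ≥0∞) ^ (1 / p.toReal) with hC
    have hCtop : C * 2 + 1 ≠ ⊤ := by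
      refine ENNReal.add_ne_top.2 ⟨ENNReal.mul_ne_top ?_ (by simp), ENNReal.one_ne_top⟩
      exact ENNReal.rpow_ne_top_of_nonneg (by positivity) (ENNReal.natCast_ne_top _)
    set δ := ε / (C * 2 + 1) with hδ_def
    have hδ : 0 < δ := ENNReal.div_pos hε.ne' hCtop
    obtain ⟨φ, hφ, hφc, hφu⟩ := exists_contDiff_eLpNorm_partialDeriv_sub_le hΩ_open hΩ_bdd hΩ_seg
      hp_one hp_top hu0 hw' hδ
    obtain ⟨M, hM⟩ := (hφ.continuous_iteratedFDeriv (m := j + 1)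
      (by exact_mod_cast le_top)).bounded_above_of_compact_support (hφc.iteratedFDeriv (j + 1))
    -- `φ` is fixed before `k` grows, so `M` and `K` do not depend on `k`. The uniform error `K * h
    -- k` costs a factor `|Ω|^(1/p)` in `L^p`.
    set K : ℝ := M * c * 2 ^ s * (nodeSumConst d (2 * s - (j + 1 : ℕ)) * τ)
    have hlim : Tendsto (fun k => (volume.restrict Ω) univ ^ p.toReal⁻¹ *
        ENNReal.ofReal (K * h k)) atTop (𝓝 0) := by
      have h1 : Tendsto (fun k => ENNReal.ofReal (K * h k)) atTop (𝓝 0) := by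
        have := ENNReal.tendsto_ofReal (hh_lim.const_mul K)
        simpa using this
      have h2 := ENNReal.Tendsto.const_mul h1 (a := (volume.restrict Ω) univ ^ p.toReal⁻¹)
        (Or.inr (ENNReal.rpow_ne_top_of_nonneg (by positivity) (measure_ne_top _ _)))
      simpa using h2
    filter_upwards [ENNReal.tendsto_nhds_zero.1 hlim δ hδ, hh_lim.eventually_le_const one_pos]
      with k hk hk1
    refine ⟨φ, ?_⟩
    have hWD : ∀ α ∈ multiIndices d j, HasWeakDeriv Ω α ((S k).interp φ - u)
        (partialDeriv α ((S k).interp φ) - w α) := by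
      intro α hα
      have hα' := mem_multiIndices.1 hα
      have hmem := (S k).memSobolev_interp hΩ_open hΩ_bdd hjr hs0 (hh_pos k) (h_decay k) p φ
      exact (hasWeakDeriv_of_contDiffOn hΩ_open ((ApproximationScheme.contDiffOn_interp
        (h_decay k).1 φ).of_le (by exact_mod_cast hα'.trans hjr))).sub (hw' α hα).1
        (MemLp.integrable_of_isBounded hΩ_bdd hp_one hmem.1)
        (MemLp.integrable_of_isBounded hΩ_bdd hp_one
          (ApproximationScheme.memLp_partialDeriv_interp hΩ_open hΩ_bdd hs0 (hh_pos k)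
            (h_decay k) p φ (hα'.trans hjr)))
        (MemLp.integrable_of_isBounded hΩ_bdd hp_one hu0)
        (MemLp.integrable_of_isBounded hΩ_bdd hp_one (hw' α hα).2)
    have hnorm : ∀ α ∈ multiIndices d j, eLpNorm (partialDeriv α ((S k).interp φ) - w α) p
        (volume.restrict Ω) ≤ δ + δ := by
      intro α hα
      have hα' := mem_multiIndices.1 hα
      have hm1 : AEStronglyMeasurable (partialDeriv α ((S k).interp φ)) (volume.restrict Ω) :=
        (ApproximationScheme.memLp_partialDeriv_interp hΩ_open hΩ_bdd hs0 (hh_pos k)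
          (h_decay k) p φ (hα'.trans hjr)).1
      have hm2 : AEStronglyMeasurable (partialDeriv α φ) (volume.restrict Ω) :=
        (contDiff_partialDeriv α hφ).continuous.aestronglyMeasurable
      have hsplit : partialDeriv α ((S k).interp φ) - w α =
          (partialDeriv α ((S k).interp φ) - partialDeriv α φ) + (partialDeriv α φ - w α) := by
        abel
      rw [hsplit]
      refine (eLpNorm_add_le (hm1.sub hm2) (hm2.sub (hw' α hα).2.1) hp_one).trans
        (add_le_add (le_trans (eLpNorm_le_of_ae_bound ?_) hk) (hφu α hα))
      filter_upwards [ae_restrict_mem hΩ_open.measurableSet] with x hx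
      exact ApproximationScheme.abs_partialDeriv_interp_sub_le hΩ_open hjn hjr hs' hc (hh_pos k)
        hk1 (h_consistent k) (h_density k) (h_decay k) hφ hM hα' hx
    calc sobolevNorm Ω j p ((S k).interp φ - u) ≤ C * (δ + δ) := sobolevNorm_le hq hWD hnorm
      _ = C * 2 * δ := by rw [← two_mul, mul_assoc]
      _ ≤ (C * 2 + 1) * δ := by
          gcongr
          exact le_self_add
      _ ≤ ε := ENNReal.mul_div_le
  obtain ⟨φ, hφ⟩ := exists_tendsto_zero_of_eventually_exists_le
    (N := fun k (φ : E d → ℝ) => sobolevNorm Ω j p ((S k).interp φ - u)) key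
  exact ⟨fun k => (S k).interp (φ k), fun k => (S k).interp_mem_space _,
    fun k => ApproximationScheme.memSobolev_interp hΩ_open hΩ_bdd hjr hs0 (hh_pos k) (h_decay k)
      p _, hφ⟩
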